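/- Let $n\ge 1$ and $S^1=\mathbb R/\mathbb Z$ with coordinate $x$, and let $B\subset (S^1)^n$ be the manifold of $n$-tuples $p=(p_1,\dots,p_n)$ of distinct, cyclically ordered points of $S^1$ (indices are taken cyclically, $p_{n+1}=p_1$; for $n=1$ the arc $[p_1,p_2]$ is the circle cut at $p_1$). Let $\mathrm{BDiff}(S^1,n)\rightrightarrows B$ be the groupoid of broken diffeomorphisms: an arrow from $p$ to $q$ is an orientation-preserving homeomorphism $\phi$ of $S^1$ with $\phi(p_i)=q_i$ for all $i$ whose restriction to each closed arc $[p_i,p_{i+1}]$ is a $C^\infty$ diffeomorphism (up to the end points) onto $[q_i,q_{i+1}]$; here $\mathrm{src}(\phi)=p$, $\mathrm{trg}(\phi)=q=\phi(p)$, and the product is composition. The space of arrows carries its natural Fréchet manifold structure, in which a family $\phi_\tau$ with parameter $\tau\in\mathbb R^k$ is smooth if source and target depend smoothly on $\tau$ and $\phi_\tau(x)$ is smooth in $(\tau,x)$ on each closed arc; a function on the space of arrows, or of composable pairs of arrows, is smooth if it is smooth along all such families. For composable arrows $\phi,\psi$ with $\mathrm{src}(\psi)=p$ put $$\chi_i(\phi,\psi)=\int_{p_i}^{p_{i+1}}\log(\phi_x\circ\psi)\,d\log\psi_x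 ,\qquad \chi=(\chi_1,\dots,\chi_n)\in\mathbb R^n .$$ Then $\chi$ is a smooth groupoid 2-cocycle, that is, a smooth function on composable pairs with $\chi(\phi,\psi\eta)+\chi(\psi,\eta)=\chi(\phi\psi,\eta)+\chi(\phi,\psi)$, and it is nontrivial: 1. $\chi$ is not a groupoid coboundary: there is no smooth function $f:\mathrm{BDiff}(S^1,n)\to\mathbb R^n$ with $\chi(\phi,\psi)=f(\phi)+f(\psi)-f(\phi\psi)$ for all composable $\phi,\psi$. 2. Consequently the broken Virasoro groupoid $\mathrm{BVir}(S^1,n)=\mathrm{BDiff}(S^1,n)\times\mathbb R^n$ over $B$, with the product $(\phi,t)(\psi,s)=(\phi\psi,\,t+s+\chi(\phi,\psi))$, is a nontrivial central extension of $\mathrm{BDiff}(S^1,n)$ by $\mathbb R^n$: there is no smooth isomorphism of groupoids with smooth inverse from it to the direct product $\mathrm{BDiff}(S^1,n)\times\mathbb R^n$ (with the product $(\phi,t)(\psi,s)=(\phi\psi,t+s)$) that is the identity on objects, covers the identity of $\mathrm{BDiff}(S^1,n)$ and commutes with translation by $\mathbb R^n$ in the second component. 3. Moreover, for every nonzero $c\in\mathbb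 R^n$ the real-valued cocycle $\sum_i c_i\chi_i$ is not a groupoid coboundary (of a smooth real-valued function). -/

import Mathlib

open CategoryTheory Set
open scoped ContDiff

noncomputable section

namespace BrokenVirasoro

/-! ### Two-cochains of groupoids and central extensions

In a Mathlib category `η ≫ ψ` means "first `η`, then `ψ`", which is the product `ψ η` of arrows. -/

section Groupoids

universe v u w

/-- A function on the arrows of a groupoid. -/
abbrev OneCochain (C : Type u) [Groupoid.{v} C] (A : Type w) :=
  ∀ ⦃a b : C⦄, (a ⟶ b) → A

/-- A function `χ(φ, ψ)` on pairs of arrows with `src φ = trg ψ`. -/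
abbrev TwoCochain (C : Type u) [Groupoid.{v} C] (A : Type w) :=
  ∀ ⦃a b c : C⦄, (b ⟶ c) → (a ⟶ b) → A

variable {C : Type u} [Groupoid.{v} C] {A : Type w} [AddCommGroup A]

/-- The cocycle identity `χ(φ, ψη) + χ(ψ, η) = χ(φψ, η) + χ(φ, ψ)`. -/
def IsTwoCocycle (χ : TwoCochain C A) : Prop :=
  ∀ ⦃a b c d : C⦄ (φ : c ⟶ d) (ψ : b ⟶ c) (η : a ⟶ b),
    χ φ (η ≫ ψ) + χ ψ η = χ (ψ ≫ φ) η + χ φ ψ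

/-- The coboundary `(φ, ψ) ↦ f(φ) + f(ψ) - f(φψ)` of a function on arrows. -/
def coboundary (f : OneCochain C A) : TwoCochain C A :=
  fun _ _ _ φ ψ => f φ + f ψ - f (ψ ≫ φ)

theorem isTwoCocycle_zero : IsTwoCocycle (fun _ _ _ _ _ => 0 : TwoCochain C A) :=
  fun _ _ _ _ _ _ _ => rfl

theorem IsTwoCocycle.right_id {χ : TwoCochain C A} (h : IsTwoCocycle χ) {a b : C} (φ : a ⟶ b) :
    χ φ (𝟙 a) = χ (𝟙 a) (𝟙 a) := by
  have := h φ (𝟙 a) (𝟙 a)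
  simp only [Category.comp_id, Category.id_comp] at this
  exact (add_left_cancel this).symm

theorem IsTwoCocycle.left_id {χ : TwoCochain C A} (h : IsTwoCocycle χ) {a b : C} (φ : a ⟶ b) :
    χ (𝟙 b) φ = χ (𝟙 b) (𝟙 b) := by
  have := h (𝟙 b) (𝟙 b) φ
  simp only [Category.comp_id] at this
  rw [add_comm] at this
  exact add_left_cancel this

/-- The objects of the central extension of `C` by `A` defined by a 2-cocycle `χ`: those of `C`. -/
structure CentralExtension (χ : TwoCochain C A) (h : IsTwoCocycle χ) where
  /-- the underlying object -/
  base : C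

/-- The central extension defined by `χ`: its arrows are the pairs `(φ, t)`, with the product
`(φ, t) (ψ, s) = (φψ, t + s + χ(φ, ψ))`. -/
instance (χ : TwoCochain C A) (h : IsTwoCocycle χ) : Groupoid (CentralExtension χ h) where
  Hom a b := (a.base ⟶ b.base) × A
  id a := (𝟙 a.base, -χ (𝟙 a.base) (𝟙 a.base))
  comp y x := (y.1 ≫ x.1, x.2 + y.2 + χ x.1 y.1)
  id_comp x := by
    refine Prod.ext (Category.id_comp _) ?_
    simp only [h.right_id x.1]
    abel
  comp_id x := by
    refine Prod.ext (Category.comp_id _) ?_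
    simp only [h.left_id x.1]
    abel
  assoc z y x := by
    refine Prod.ext (Category.assoc _ _ _) ?_
    have := h x.1 y.1 z.1
    simp only
    calc x.2 + (y.2 + z.2 + χ y.1 z.1) + χ x.1 (z.1 ≫ y.1)
        = x.2 + y.2 + z.2 + (χ x.1 (z.1 ≫ y.1) + χ y.1 z.1) := by abel
      _ = x.2 + y.2 + z.2 + (χ (y.1 ≫ x.1) z.1 + χ x.1 y.1) := by rw [this]
      _ = _ := by abel
  inv {a b} x :=
    (Groupoid.inv x.1,
      -x.2 - χ x.1 (Groupoid.inv x.1) - χ (𝟙 b.base) (𝟙 b.base))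
  inv_comp x := by
    refine Prod.ext (Groupoid.inv_comp _) ?_
    simp only
    abel
  comp_inv {a b} x := by
    refine Prod.ext (Groupoid.comp_inv _) ?_
    have h1 := h x.1 (Groupoid.inv x.1) x.1
    rw [Groupoid.comp_inv, Groupoid.inv_comp, h.right_id, h.left_id x.1] at h1
    simp only
    rw [eq_sub_of_add_eq' h1]
    abel

/-- An equivalence between two central extensions of `C` by `A`: an isomorphism of groupoids which
is the identity on objects, covers the identity of `C` and commutes with the action of `A` on
arrows by translation of the second component. -/
structure ExtensionEquiv {χ χ' : TwoCochain C A} (h : IsTwoCocycle χ) (h' : IsTwoCocycle χ') where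
  /-- the bijection on arrows -/
  equiv : ∀ {a b : C}, ((⟨a⟩ : CentralExtension χ h) ⟶ ⟨b⟩) ≃
    ((⟨a⟩ : CentralExtension χ' h') ⟶ ⟨b⟩)
  map_comp : ∀ {a b c : C} (y : (⟨a⟩ : CentralExtension χ h) ⟶ ⟨b⟩)
    (x : (⟨b⟩ : CentralExtension χ h) ⟶ ⟨c⟩), equiv (y ≫ x) = equiv y ≫ equiv x
  fst_map : ∀ {a b : C} (x : (⟨a⟩ : CentralExtension χ h) ⟶ ⟨b⟩), (equiv x).1 = x.1
  map_add : ∀ {a b : C} (φ : a ⟶ b) (s t : A), (equiv (φ, s + t)).2 = (equiv (φ, s)).2 + t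

end Groupoids

/-! ### The circle, break points and broken diffeomorphisms -/

/-- The representative in `(0, 1]` of a point of the circle `ℝ / ℤ`. -/
def posRep (y : UnitAddCircle) : ℝ := (AddCircle.equivIoc (1 : ℝ) 0 y : ℝ)

theorem posRep_mem (y : UnitAddCircle) : posRep y ∈ Ioc (0 : ℝ) 1 := by
  have h := (AddCircle.equivIoc (1 : ℝ) 0 y).2
  exact ⟨h.1, h.2.trans_eq (zero_add 1)⟩

theorem coe_posRep (y : UnitAddCircle) : ((posRep y : ℝ) : UnitAddCircle) = y :=
  AddCircle.coe_equivIoc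

theorem posRep_coe {t : ℝ} (ht : t ∈ Ioc (0 : ℝ) 1) : posRep (t : UnitAddCircle) = t :=
  AddCircle.equivIoc_coe_of_mem (by simpa using ht)

/-- The base `B ⊂ (S¹)ⁿ`: the `n`-tuples of distinct, cyclically ordered points of the circle,
that is, those which go once around the circle in the positive direction. -/
structure BreakPoints (n : ℕ) where
  /-- the points -/
  pt : Fin n → UnitAddCircle
  cyclic : ∃ x : Fin n → ℝ, StrictMono x ∧ (∀ i j, x i < x j + 1) ∧
    ∀ i, ((x i : ℝ) : UnitAddCircle) = pt i

variable {n : ℕ}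

/-- The length of the arc `[p_i, p_{i+1}]`, run through in the positive direction; indices are
taken cyclically. For `n = 1` this arc is the circle cut at `p_1`, of length `1`. -/
def arcLen [NeZero n] (p : BreakPoints n) (i : Fin n) : ℝ := posRep (p.pt (i + 1) - p.pt i)

/-- A map `φ` of the circle in the arc length coordinates measured from `x` in the source and from
`φ x` in the target, in the positive direction: `φ (x + t) = φ x + arcMap φ x t` for
`0 ≤ t ≤ 1`. -/
def arcMap (φ : UnitAddCircle → UnitAddCircle) (x : UnitAddCircle) (t : ℝ) : ℝ :=
  if t ≤ 0 then 0 else posRep (φ (x + (t : UnitAddCircle)) - φ x)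

theorem arcMap_of_nonpos (φ : UnitAddCircle → UnitAddCircle) (x : UnitAddCircle) {t : ℝ}
    (ht : t ≤ 0) : arcMap φ x t = 0 := by
  simp [arcMap, ht]

theorem arcMap_pos (φ : UnitAddCircle → UnitAddCircle) (x : UnitAddCircle) {t : ℝ}
    (ht : 0 < t) : 0 < arcMap φ x t := by
  rw [arcMap, if_neg ht.not_ge]
  exact (posRep_mem _).1

theorem apply_add_coe (φ : UnitAddCircle → UnitAddCircle) (x : UnitAddCircle) {t : ℝ}
    (ht : 0 ≤ t) : φ (x + (t : UnitAddCircle)) = φ x + ((arcMap φ x t : ℝ) : UnitAddCircle) := by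
  rcases ht.eq_or_lt with rfl | ht
  · simp [arcMap]
  · rw [arcMap, if_neg ht.not_ge, coe_posRep]
    abel

theorem arcMap_id (x : UnitAddCircle) {t : ℝ} (ht : t ∈ Icc (0 : ℝ) 1) : arcMap id x t = t := by
  rcases ht.1.eq_or_lt with rfl | h
  · simp [arcMap]
  · rw [arcMap, if_neg h.not_ge, id, id, add_sub_cancel_left, posRep_coe ⟨h, ht.2⟩]

theorem arcMap_comp (φ ψ : UnitAddCircle → UnitAddCircle) (x : UnitAddCircle) (t : ℝ) :
    arcMap (φ ∘ ψ) x t = arcMap φ (ψ x) (arcMap ψ x t) := by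
  rcases le_or_gt t 0 with ht | ht
  · rw [arcMap_of_nonpos _ _ ht, arcMap_of_nonpos ψ _ ht, arcMap_of_nonpos _ _ le_rfl]
  · have h := arcMap_pos ψ x ht
    rw [arcMap, if_neg ht.not_ge, arcMap, if_neg h.not_ge, ← apply_add_coe ψ x ht.le]
    rfl

variable [NeZero n]

theorem arcLen_mem (p : BreakPoints n) (i : Fin n) : arcLen p i ∈ Ioc (0 : ℝ) 1 := posRep_mem _

theorem pt_add_arcLen (p : BreakPoints n) (i : Fin n) :
    p.pt i + ((arcLen p i : ℝ) : UnitAddCircle) = p.pt (i + 1) := by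
  rw [arcLen, coe_posRep]
  abel

/-- An arrow `p ⟶ q` of the groupoid of broken diffeomorphisms: a homeomorphism `φ` of the circle
with `φ(p_i) = q_i` for all `i`, which restricts to an orientation preserving diffeomorphism, smooth
up to the end points, of each closed arc `[p_i, p_{i+1}]` onto its image `[q_i, q_{i+1}]`.
(The coordinate expression of an orientation reversing map is discontinuous at `0`.) -/
@[ext]
structure BrokenDiffeo (p q : BreakPoints n) where
  /-- the homeomorphism -/
  toHomeo : UnitAddCircle ≃ₜ UnitAddCircle
  map_pt : ∀ i, toHomeo (p.pt i) = q.pt i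
  smooth : ∀ i, ContDiffOn ℝ ∞ (arcMap toHomeo (p.pt i)) (Icc 0 (arcLen p i))
  smooth_symm : ∀ i, ContDiffOn ℝ ∞ (arcMap toHomeo.symm (q.pt i)) (Icc 0 (arcLen q i))

namespace BrokenDiffeo

variable {p q r : BreakPoints n}

theorem arcMap_arcLen (φ : BrokenDiffeo p q) (i : Fin n) :
    arcMap φ.toHomeo (p.pt i) (arcLen p i) = arcLen q i := by
  rw [arcMap, if_neg (arcLen_mem p i).1.not_ge, pt_add_arcLen, φ.map_pt, φ.map_pt, arcLen]

theorem strictMonoOn (φ : BrokenDiffeo p q) (i : Fin n) :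
    StrictMonoOn (arcMap φ.toHomeo (p.pt i)) (Icc 0 (arcLen p i)) := by
  refine ContinuousOn.strictMonoOn_of_injOn_Icc (arcLen_mem p i).1.le ?_
    (φ.smooth i).continuousOn ?_
  · rw [arcMap_of_nonpos _ _ le_rfl, arcMap_arcLen]
    exact (arcLen_mem q i).1.le
  · intro s hs t ht hst
    have h : arcMap φ.toHomeo.symm (φ.toHomeo (p.pt i)) (arcMap φ.toHomeo (p.pt i) s) =
        arcMap φ.toHomeo.symm (φ.toHomeo (p.pt i)) (arcMap φ.toHomeo (p.pt i) t) := by rw [hst]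
    rw [← arcMap_comp, ← arcMap_comp, Homeomorph.symm_comp_self,
      arcMap_id _ ⟨hs.1, hs.2.trans (arcLen_mem p i).2⟩,
      arcMap_id _ ⟨ht.1, ht.2.trans (arcLen_mem p i).2⟩] at h
    exact h

theorem mapsTo (φ : BrokenDiffeo p q) (i : Fin n) :
    MapsTo (arcMap φ.toHomeo (p.pt i)) (Icc 0 (arcLen p i)) (Icc 0 (arcLen q i)) := by
  have h0 : (0 : ℝ) ≤ arcLen p i := (arcLen_mem p i).1.le
  intro t ht
  constructor
  · rw [← arcMap_of_nonpos φ.toHomeo (p.pt i) le_rfl]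
    exact (φ.strictMonoOn i).monotoneOn ⟨le_rfl, h0⟩ ht ht.1
  · rw [← φ.arcMap_arcLen i]
    exact (φ.strictMonoOn i).monotoneOn ht ⟨h0, le_rfl⟩ ht.2

/-- The inverse of a broken diffeomorphism. -/
def symm (φ : BrokenDiffeo p q) : BrokenDiffeo q p where
  toHomeo := φ.toHomeo.symm
  map_pt i := by rw [← φ.map_pt i, Homeomorph.symm_apply_apply]
  smooth := φ.smooth_symm
  smooth_symm := φ.smooth

theorem contDiffOn_comp (φ : BrokenDiffeo q r) (ψ : BrokenDiffeo p q) (i : Fin n) :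
    ContDiffOn ℝ ∞ (arcMap (φ.toHomeo ∘ ψ.toHomeo) (p.pt i)) (Icc 0 (arcLen p i)) := by
  have h : arcMap (φ.toHomeo ∘ ψ.toHomeo) (p.pt i) =
      arcMap φ.toHomeo (q.pt i) ∘ arcMap ψ.toHomeo (p.pt i) := by
    funext t
    rw [arcMap_comp, ψ.map_pt]
    rfl
  rw [h]
  exact (φ.smooth i).comp (ψ.smooth i) (ψ.mapsTo i)

/-- The composition `φ ∘ ψ`. -/
def comp (φ : BrokenDiffeo q r) (ψ : BrokenDiffeo p q) : BrokenDiffeo p r where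
  toHomeo := ψ.toHomeo.trans φ.toHomeo
  map_pt i := by rw [Homeomorph.trans_apply, ψ.map_pt, φ.map_pt]
  smooth i := contDiffOn_comp φ ψ i
  smooth_symm i := contDiffOn_comp ψ.symm φ.symm i

theorem contDiffOn_id (p : BreakPoints n) (i : Fin n) :
    ContDiffOn ℝ ∞ (arcMap id (p.pt i)) (Icc 0 (arcLen p i)) :=
  _root_.contDiffOn_id.congr fun _ ht => arcMap_id _ ⟨ht.1, ht.2.trans (arcLen_mem p i).2⟩

/-- The identity of the circle as a broken diffeomorphism. -/
def refl (p : BreakPoints n) : BrokenDiffeo p p where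
  toHomeo := Homeomorph.refl _
  map_pt _ := rfl
  smooth i := contDiffOn_id p i
  smooth_symm i := contDiffOn_id p i

end BrokenDiffeo

/-- The groupoid `BDiff(S¹, n)` of broken diffeomorphisms over `B`, with `src φ = p` and
`trg φ = φ(p)`; the product is the composition of homeomorphisms. -/
instance : Groupoid (BreakPoints n) where
  Hom p q := BrokenDiffeo p q
  id p := BrokenDiffeo.refl p
  comp ψ φ := BrokenDiffeo.comp φ ψ
  id_comp _ := BrokenDiffeo.ext rfl
  comp_id _ := BrokenDiffeo.ext rfl
  assoc _ _ _ := BrokenDiffeo.ext rfl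
  inv φ := BrokenDiffeo.symm φ
  inv_comp φ := BrokenDiffeo.ext (Homeomorph.symm_trans_self φ.toHomeo)
  comp_inv φ := BrokenDiffeo.ext (Homeomorph.self_trans_symm φ.toHomeo)

/-- The coordinate expression `[0, arcLen p i] → [0, arcLen q i]` of a broken diffeomorphism
`φ : p ⟶ q` on the arc `[p_i, p_{i+1}]`; its derivative is `φ_x`. -/
def onArc {p q : BreakPoints n} (φ : p ⟶ q) (i : Fin n) : ℝ → ℝ :=
  arcMap (BrokenDiffeo.toHomeo φ) (p.pt i)

/-- The broken Bott cocycle `χ = (χ_1, …, χ_n)`,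
`χ_i(φ, ψ) = ∫_{p_i}^{p_{i+1}} log(φ_x ∘ ψ) d log ψ_x` where `p = src ψ`, the arc being
parametrized by arc length from `p_i`. -/
def bottCocycle (n : ℕ) [NeZero n] : TwoCochain (BreakPoints n) (Fin n → ℝ) :=
  fun p _ _ φ ψ i =>
    ∫ t in (0 : ℝ)..(arcLen p i),
      Real.log (deriv (onArc φ i) (onArc ψ i t)) *
        deriv (fun s => Real.log (deriv (onArc ψ i) s)) t

/-! ### Smoothness

The Fréchet manifold structure of the space of arrows of `BDiff(S¹, n)` is expressed through its
smooth finite-dimensional families: a function on a Fréchet manifold is smooth if and only if it is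
smooth along these. -/

/-- A family of points of the circle is smooth: it lifts to a smooth real-valued function. -/
def IsSmoothCircleFamily {k : ℕ} (x : (Fin k → ℝ) → UnitAddCircle) : Prop :=
  ∃ a : (Fin k → ℝ) → ℝ, ContDiff ℝ ∞ a ∧ ∀ τ, ((a τ : ℝ) : UnitAddCircle) = x τ

/-- A smooth family of broken diffeomorphisms `φ_τ : p_τ ⟶ q_τ` with parameters `τ ∈ ℝᵏ`: the source
and the target are smooth in `τ`, and on each arc `φ_τ(x)` is smooth in `(τ, x)` jointly, up to the
end points of the arc. -/
structure IsSmoothFamily {k : ℕ} {p q : (Fin k → ℝ) → BreakPoints n}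
    (φ : ∀ τ, p τ ⟶ q τ) : Prop where
  source : ∀ i, IsSmoothCircleFamily fun τ => (p τ).pt i
  target : ∀ i, IsSmoothCircleFamily fun τ => (q τ).pt i
  arcs : ∀ i, ContDiffOn ℝ ∞ (fun z : (Fin k → ℝ) × ℝ => onArc (φ z.1) i z.2)
    {z | z.2 ∈ Icc 0 (arcLen (p z.1) i)}

section Smoothness

universe w

variable {A : Type w} [NormedAddCommGroup A] [NormedSpace ℝ A]

/-- A smooth function on the space of arrows of `BDiff(S¹, n)`. -/
def IsSmoothOneCochain (f : OneCochain (BreakPoints n) A) : Prop :=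
  ∀ ⦃k : ℕ⦄ ⦃p q : (Fin k → ℝ) → BreakPoints n⦄ (φ : ∀ τ, p τ ⟶ q τ),
    IsSmoothFamily φ → ContDiff ℝ ∞ fun τ => f (φ τ)

/-- A smooth function on the space of composable pairs of arrows of `BDiff(S¹, n)`. -/
def IsSmoothTwoCochain (χ : TwoCochain (BreakPoints n) A) : Prop :=
  ∀ ⦃k : ℕ⦄ ⦃p q r : (Fin k → ℝ) → BreakPoints n⦄ (φ : ∀ τ, q τ ⟶ r τ) (ψ : ∀ τ, p τ ⟶ q τ),
    IsSmoothFamily φ → IsSmoothFamily ψ → ContDiff ℝ ∞ fun τ => χ (φ τ) (ψ τ)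

/-- `χ` is a groupoid coboundary: `χ(φ, ψ) = f(φ) + f(ψ) - f(φψ)` with a smooth function `f` on the
space of arrows. -/
def IsCoboundary (χ : TwoCochain (BreakPoints n) A) : Prop :=
  ∃ f : OneCochain (BreakPoints n) A, IsSmoothOneCochain f ∧ χ = coboundary f

/-- A smooth family of arrows of a central extension, whose space of arrows is the product of the
space of arrows of `BDiff(S¹, n)` with `A`. -/
def IsSmoothExtFamily {χ : TwoCochain (BreakPoints n) A} {h : IsTwoCocycle χ} {k : ℕ}
    {p q : (Fin k → ℝ) → BreakPoints n}
    (x : ∀ τ, (⟨p τ⟩ : CentralExtension χ h) ⟶ ⟨q τ⟩) : Prop :=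
  IsSmoothFamily (fun τ => (x τ).1) ∧ ContDiff ℝ ∞ fun τ => (x τ).2

/-- An equivalence of central extensions is smooth with smooth inverse. -/
def ExtensionEquiv.IsSmooth {χ χ' : TwoCochain (BreakPoints n) A} {h : IsTwoCocycle χ}
    {h' : IsTwoCocycle χ'} (F : ExtensionEquiv h h') : Prop :=
  ∀ ⦃k : ℕ⦄ ⦃p q : (Fin k → ℝ) → BreakPoints n⦄,
    (∀ x : ∀ τ, (⟨p τ⟩ : CentralExtension χ h) ⟶ ⟨q τ⟩,
      IsSmoothExtFamily x → IsSmoothExtFamily fun τ => F.equiv (x τ)) ∧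
    (∀ y : ∀ τ, (⟨p τ⟩ : CentralExtension χ' h') ⟶ ⟨q τ⟩,
      IsSmoothExtFamily y → IsSmoothExtFamily fun τ => F.equiv.symm (y τ))

/-- The central extension defined by `χ` is trivial: it is smoothly equivalent to the direct product
of `BDiff(S¹, n)` and the additive group `A`, which is the extension defined by the zero cocycle. -/
def IsTrivialExtension {χ : TwoCochain (BreakPoints n) A} (h : IsTwoCocycle χ) : Prop :=
  ∃ F : ExtensionEquiv h (isTwoCocycle_zero (C := BreakPoints n) (A := A)), F.IsSmooth

end Smoothness

end BrokenVirasoro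

end

noncomputable section

namespace BrokenVirasoro

/-! ### Integrals depending smoothly on parameters -/

/-! The cocycle identity and smoothness are calculus on the arcs. For ℓ(φ) = log φ_x the chain rule
reads ℓ(φψ) = ℓ(φ)∘ψ + ℓ(ψ); once the integral χ_i(φ, ψ) is pulled back along η, the identity holds
already for the integrands (`isTwoCocycle_bottCocycle`). For smoothness, all arcs are rescaled to
[0, 1] and one differentiates under the integral sign (`isSmoothTwoCochain_bottCocycle`).

Nontriviality is seen on a single arc with c_i ≠ 0, using arrows that fix the points j/n and are the
identity off that arc; only χ_i survives on them. If c_i χ_i is the coboundary of a smooth f,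
antisymmetrising gives c_i(χ_i(φ, ψ) - χ_i(ψ, φ)) = f(ψφ) - f(φψ). Take φ, ψ with logarithmic
derivatives sg, sh up to constants, where g = u', h = v', the fields u, v vanish at both ends of the
arc, and g, h each take equal values there. The terms of order s² give c_i ∫ (g h' - h g') = df(w)
with w = (u v' - v u')' (`integral_eq_arcDifferential`): the Gelfand-Fuchs integral would depend
only on the bracket of u and v.

It does not. With L = 1/n and H = t²(L - t)², the pairs (H, Ht³) and (Ht, Ht²) have brackets 3H²t²
and H²t², whereas the first integral minus three times the second is -6∫H²
(`not_isCoboundary_sum_bottCocycle`). The vector-valued case follows by summing components, and a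
trivialisation of the extension would produce such an f (`IsTrivialExtension.isCoboundary`). -/

theorem hasFDerivAt_parametric_integral {H F : Type} [NormedAddCommGroup H] [NormedSpace ℝ H]
    [ProperSpace H] [NormedAddCommGroup F] [NormedSpace ℝ F] [CompleteSpace F]
    {f : H × ℝ → F} (hf : ContDiff ℝ 1 f) (a b : ℝ) (x : H) :
    HasFDerivAt (fun x => ∫ s in a..b, f (x, s))
      (∫ s in a..b, (fderiv ℝ f (x, s)).comp (ContinuousLinearMap.inl ℝ H ℝ)) x := by
  have hc : Continuous fun z : H × ℝ =>
      (fderiv ℝ f z).comp (ContinuousLinearMap.inl ℝ H ℝ) :=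
    (hf.continuous_fderiv one_ne_zero).clm_comp continuous_const
  -- The dominating constant comes from compactness of the closed unit ball around `x`; this is
  -- where `ProperSpace` enters.
  obtain ⟨C, hC⟩ := ((isCompact_closedBall x 1).prod (isCompact_uIcc (a := a) (b := b))
    ).exists_bound_of_continuousOn hc.continuousOn
  refine (intervalIntegral.hasFDerivAt_integral_of_dominated_of_fderiv_le
    (F' := fun y s => (fderiv ℝ f (y, s)).comp (ContinuousLinearMap.inl ℝ H ℝ))
    (bound := fun _ => C)
    (Metric.closedBall_mem_nhds x one_pos) ?_ ?_ ?_ ?_ ?_ ?_)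
  · exact Filter.Eventually.of_forall fun y =>
      (hf.continuous.comp (by fun_prop)).aestronglyMeasurable
  · exact (hf.continuous.comp (by fun_prop)).intervalIntegrable _ _
  · exact (hc.comp (by fun_prop : Continuous fun s : ℝ => (x, s))).aestronglyMeasurable
  · exact Filter.Eventually.of_forall fun s hs y hy => hC (y, s) ⟨hy, uIoc_subset_uIcc hs⟩
  · exact intervalIntegrable_const
  · refine Filter.Eventually.of_forall fun s _ y _ => ?_
    have h1 : HasFDerivAt f (fderiv ℝ f (y, s)) (y, s) :=
      (hf.differentiable one_ne_zero _).hasFDerivAt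
    exact h1.comp y (hasFDerivAt_prodMk_left y s)

/-- The derivative of the integral is an integral of the same kind with values in `H →L[ℝ] F`, so
the induction on `m` must leave the target space free. -/
theorem contDiff_nat_parametric_integral (m : ℕ) :
    ∀ {H F : Type} [NormedAddCommGroup H] [NormedSpace ℝ H]
      [ProperSpace H] [NormedAddCommGroup F] [NormedSpace ℝ F] [CompleteSpace F]
      {f : H × ℝ → F}, ContDiff ℝ m f → ∀ a b : ℝ,
      ContDiff ℝ m (fun x => ∫ s in a..b, f (x, s)) := by
  induction m with
  | zero =>
    intro H F _ _ _ _ _ _ f hf a b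
    rw [Nat.cast_zero, contDiff_zero] at hf ⊢
    exact intervalIntegral.continuous_parametric_intervalIntegral_of_continuous'
      (f := fun x s => f (x, s)) hf a b
  | succ m ih =>
    intro H F _ _ _ _ _ _ f hf a b
    push_cast at hf ⊢
    rw [contDiff_succ_iff_hasFDerivAt]
    refine ⟨_, ih (F := H →L[ℝ] F)
      (f := fun z => (fderiv ℝ f z).comp (ContinuousLinearMap.inl ℝ H ℝ)) ?_ a b, fun x => ?_⟩
    · exact (hf.fderiv_right le_rfl).clm_comp contDiff_const
    · exact hasFDerivAt_parametric_integral (hf.of_le (by simp)) a b x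

theorem contDiff_parametric_integral {H F : Type} [NormedAddCommGroup H] [NormedSpace ℝ H]
    [ProperSpace H] [NormedAddCommGroup F] [NormedSpace ℝ F] [CompleteSpace F]
    {f : H × ℝ → F} (hf : ContDiff ℝ ∞ f) (a b : ℝ) :
    ContDiff ℝ ∞ (fun x => ∫ s in a..b, f (x, s)) :=
  contDiff_infty.2 fun m => contDiff_nat_parametric_integral m (contDiff_infty.1 hf m) a b

/-- A variable upper limit of integration is allowed as well. -/
theorem contDiff_parametric_primitive {H : Type} [NormedAddCommGroup H] [NormedSpace ℝ H]
    [ProperSpace H] {f : H × ℝ → ℝ} (hf : ContDiff ℝ ∞ f) :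
    ContDiff ℝ ∞ (fun z : H × ℝ => ∫ s in (0 : ℝ)..z.2, f (z.1, s)) := by
  -- Scaling the integration variable by the upper limit makes the limits constant.
  have h : (fun z : H × ℝ => ∫ s in (0 : ℝ)..z.2, f (z.1, s)) =
      fun z => z.2 * ∫ s in (0 : ℝ)..1, f (z.1, z.2 * s) := by
    funext z
    rw [intervalIntegral.mul_integral_comp_mul_left (f := fun s => f (z.1, s))]
    simp
  rw [h]
  refine contDiff_snd.mul (contDiff_parametric_integral
    (f := fun w : (H × ℝ) × ℝ => f (w.1.1, w.1.2 * w.2)) ?_ 0 1)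
  exact hf.comp (by fun_prop)

/-- Hadamard's lemma: a smooth function is divisible by the parameter where it vanishes. -/
theorem exists_hadamard {f : ℝ × ℝ → ℝ} (hf : ContDiff ℝ ∞ f) :
    ∃ A : ℝ × ℝ → ℝ, ContDiff ℝ ∞ A ∧ (∀ s x, f (s, x) = f (0, x) + s * A (s, x)) ∧
      ∀ x, A (0, x) = deriv (fun s => f (s, x)) 0 := by
  have hd : ∀ x s, HasDerivAt (fun s => f (s, x)) (fderiv ℝ f (s, x) (1, 0)) s := fun x s => by
    have h1 : HasFDerivAt f (fderiv ℝ f (s, x)) (s, x) :=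
      (hf.differentiable (by simp) _).hasFDerivAt
    exact h1.comp_hasDerivAt s ((hasDerivAt_id s).prodMk (hasDerivAt_const s x))
  have hs : ContDiff ℝ ∞ fun z => fderiv ℝ f z (1, 0) :=
    (hf.fderiv_right (m := ∞) (by simp)).clm_apply contDiff_const
  -- The quotient is the mean of ∂f/∂s over the segment from 0 to s.
  refine ⟨fun z => ∫ θ in (0 : ℝ)..1, fderiv ℝ f (z.1 * θ, z.2) (1, 0),
    contDiff_parametric_integral
      (f := fun w : (ℝ × ℝ) × ℝ => fderiv ℝ f (w.1.1 * w.2, w.1.2) (1, 0)) ?_ 0 1, ?_, ?_⟩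
  · exact hs.comp (g := fun z => fderiv ℝ f z (1, 0))
      (f := fun w : (ℝ × ℝ) × ℝ => (w.1.1 * w.2, w.1.2)) (by fun_prop)
  · intro s x
    have h2 := intervalIntegral.mul_integral_comp_mul_left
      (f := fun θ => fderiv ℝ f (θ, x) (1, 0)) s (a := 0) (b := 1)
    simp only
    rw [h2, mul_zero, mul_one, intervalIntegral.integral_eq_sub_of_hasDerivAt (fun θ _ => hd x θ)]
    · ring
    · exact (hs.continuous.comp (by fun_prop : Continuous fun θ : ℝ => (θ, x))
        ).intervalIntegrable _ _
  · intro x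
    simp [(hd x 0).deriv]

/-! ### Functions smooth up to the boundary of a strip -/

theorem uniqueDiffOn_strip (H : Type*) [NormedAddCommGroup H] [NormedSpace ℝ H] :
    UniqueDiffOn ℝ ((univ : Set H) ×ˢ Icc (0 : ℝ) 1) :=
  uniqueDiffOn_univ.prod (uniqueDiffOn_Icc one_pos)

/-- The partial derivative is the full `fderivWithin` evaluated on (0, 1), and the latter is smooth
because the strip has unique differentials. -/
theorem contDiffOn_strip_derivWithin {H : Type*} [NormedAddCommGroup H] [NormedSpace ℝ H]
    {f : H × ℝ → ℝ} (hf : ContDiffOn ℝ ∞ f (univ ×ˢ Icc (0 : ℝ) 1)) :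
    ContDiffOn ℝ ∞ (fun z => derivWithin (fun s => f (z.1, s)) (Icc 0 1) z.2)
      (univ ×ˢ Icc (0 : ℝ) 1) := by
  refine ((hf.fderivWithin (uniqueDiffOn_strip H) (m := ∞) (by simp)).clm_apply
    (contDiffOn_const (c := ((0, 1) : H × ℝ)))).congr ?_
  rintro ⟨τ, s⟩ ⟨-, hs⟩
  have h1 := (hf.differentiableOn (by simp) (τ, s) ⟨mem_univ _, hs⟩).hasFDerivWithinAt
  have h2 : HasDerivWithinAt (fun s : ℝ => (τ, s)) ((0, 1) : H × ℝ) (Icc 0 1) s :=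
    (hasDerivWithinAt_const s _ τ).prodMk (hasDerivWithinAt_id s _)
  exact (h1.comp_hasDerivWithinAt s h2 (fun t ht => ⟨mem_univ _, ht⟩)).derivWithin
    (uniqueDiffOn_Icc one_pos s hs)

/-- The integrand is controlled only on the closed strip. The substitution s = sin² σ maps the whole
line into [0, 1], so the new integrand is smooth everywhere and no extension across the boundary is
needed. -/
theorem contDiff_integral_strip {H : Type} [NormedAddCommGroup H] [NormedSpace ℝ H]
    [ProperSpace H] {f : H × ℝ → ℝ} (hf : ContDiffOn ℝ ∞ f (univ ×ˢ Icc (0 : ℝ) 1)) :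
    ContDiff ℝ ∞ fun x => ∫ s in (0 : ℝ)..1, f (x, s) := by
  have hθ : ∀ σ, HasDerivAt (fun σ : ℝ => Real.sin σ ^ 2) (2 * Real.sin σ * Real.cos σ) σ := by
    intro σ
    simpa [Pi.pow_def] using (Real.hasDerivAt_sin σ).pow 2
  have hm : ∀ σ : ℝ, Real.sin σ ^ 2 ∈ Icc (0 : ℝ) 1 := fun σ =>
    ⟨sq_nonneg _, Real.sin_sq_le_one σ⟩
  have h : ∀ x, ∫ s in (0 : ℝ)..1, f (x, s) =
      ∫ σ in (0 : ℝ)..(Real.pi / 2),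
        f (x, Real.sin σ ^ 2) * (2 * Real.sin σ * Real.cos σ) := by
    intro x
    have hc : ContinuousOn (fun s => f (x, s)) (Icc 0 1) :=
      hf.continuousOn.comp (by fun_prop) (fun s hs => ⟨mem_univ _, hs⟩)
    have := intervalIntegral.integral_comp_mul_deriv''' (a := 0) (b := Real.pi / 2)
      (f := fun σ => Real.sin σ ^ 2) (f' := fun σ => 2 * Real.sin σ * Real.cos σ)
      (g := fun s => f (x, s)) (by fun_prop) (fun σ _ => (hθ σ).hasDerivWithinAt)
      (hc.mono (by rintro _ ⟨σ, -, rfl⟩; exact hm σ))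
      ((hc.integrableOn_Icc).mono_set (by rintro _ ⟨σ, -, rfl⟩; exact hm σ)) ?_
    · simpa using this.symm
    · refine (Continuous.continuousOn ?_).integrableOn_uIcc
      exact (hc.comp_continuous (by fun_prop) hm).mul (by fun_prop)
  simp_rw [h]
  refine contDiff_parametric_integral
    (f := fun z : H × ℝ => f (z.1, Real.sin z.2 ^ 2) * (2 * Real.sin z.2 * Real.cos z.2)) ?_ _ _
  refine (hf.comp_contDiff (f := fun z : H × ℝ => (z.1, Real.sin z.2 ^ 2)) (by fun_prop)
    fun z => ⟨mem_univ _, hm _⟩).mul (by fun_prop)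

variable {n : ℕ} [NeZero n]

/-! ### The derivative of a broken diffeomorphism on an arc -/

section Arcs

variable {p q r : BreakPoints n}

theorem arcLen_pos (p : BreakPoints n) (i : Fin n) : 0 < arcLen p i := (arcLen_mem p i).1

theorem uniqueDiffOn_arc (p : BreakPoints n) (i : Fin n) :
    UniqueDiffOn ℝ (Icc 0 (arcLen p i)) := uniqueDiffOn_Icc (arcLen_pos p i)

theorem contDiffOn_onArc (φ : p ⟶ q) (i : Fin n) :
    ContDiffOn ℝ ∞ (onArc φ i) (Icc 0 (arcLen p i)) := BrokenDiffeo.smooth φ i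

theorem mapsTo_onArc (φ : p ⟶ q) (i : Fin n) :
    MapsTo (onArc φ i) (Icc 0 (arcLen p i)) (Icc 0 (arcLen q i)) := BrokenDiffeo.mapsTo φ i

theorem onArc_zero (φ : p ⟶ q) (i : Fin n) : onArc φ i 0 = 0 := arcMap_of_nonpos _ _ le_rfl

theorem onArc_arcLen (φ : p ⟶ q) (i : Fin n) : onArc φ i (arcLen p i) = arcLen q i :=
  BrokenDiffeo.arcMap_arcLen φ i

theorem strictMonoOn_onArc (φ : p ⟶ q) (i : Fin n) :
    StrictMonoOn (onArc φ i) (Icc 0 (arcLen p i)) := BrokenDiffeo.strictMonoOn φ i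

theorem onArc_mem_Ioo (φ : p ⟶ q) (i : Fin n) {t : ℝ} (ht : t ∈ Ioo 0 (arcLen p i)) :
    onArc φ i t ∈ Ioo 0 (arcLen q i) := by
  have hm := strictMonoOn_onArc φ i
  have h0 := (arcLen_pos p i).le
  constructor
  · rw [← onArc_zero φ i]
    exact hm ⟨le_rfl, h0⟩ (Ioo_subset_Icc_self ht) ht.1
  · rw [← onArc_arcLen φ i]
    exact hm (Ioo_subset_Icc_self ht) ⟨h0, le_rfl⟩ ht.2

theorem onArc_comp (ψ : p ⟶ q) (φ : q ⟶ r) (i : Fin n) (t : ℝ) :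
    onArc (ψ ≫ φ) i t = onArc φ i (onArc ψ i t) := by
  have h := arcMap_comp (BrokenDiffeo.toHomeo φ) (BrokenDiffeo.toHomeo ψ) (p.pt i) t
  rw [BrokenDiffeo.map_pt ψ i] at h
  exact h

theorem onArc_id {i : Fin n} {t : ℝ} (ht : t ∈ Icc 0 (arcLen p i)) : onArc (𝟙 p) i t = t :=
  arcMap_id _ ⟨ht.1, ht.2.trans (arcLen_mem p i).2⟩

theorem hasDerivWithinAt_onArc (φ : p ⟶ q) (i : Fin n) {t : ℝ} (ht : t ∈ Icc 0 (arcLen p i)) :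
    HasDerivWithinAt (onArc φ i) (derivWithin (onArc φ i) (Icc 0 (arcLen p i)) t)
      (Icc 0 (arcLen p i)) t :=
  ((contDiffOn_onArc φ i).differentiableOn (by simp) t ht).hasDerivWithinAt

theorem derivWithin_onArc_comp (ψ : p ⟶ q) (φ : q ⟶ r) (i : Fin n) {t : ℝ}
    (ht : t ∈ Icc 0 (arcLen p i)) :
    derivWithin (onArc (ψ ≫ φ) i) (Icc 0 (arcLen p i)) t =
      derivWithin (onArc φ i) (Icc 0 (arcLen q i)) (onArc ψ i t) *
        derivWithin (onArc ψ i) (Icc 0 (arcLen p i)) t := by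
  have h := (hasDerivWithinAt_onArc φ i (mapsTo_onArc ψ i ht)).comp t
    (hasDerivWithinAt_onArc ψ i ht) (mapsTo_onArc ψ i)
  refine HasDerivWithinAt.derivWithin ?_ (uniqueDiffOn_arc p i t ht)
  exact h.congr (fun s _ => onArc_comp ψ φ i s) (onArc_comp ψ φ i t)

/-- Monotonicity gives a nonnegative derivative; the chain rule for φ⁻¹φ = id excludes zero, also at
the end points. -/
theorem derivWithin_onArc_pos (φ : p ⟶ q) (i : Fin n) {t : ℝ} (ht : t ∈ Icc 0 (arcLen p i)) :
    0 < derivWithin (onArc φ i) (Icc 0 (arcLen p i)) t := by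
  refine lt_of_le_of_ne (strictMonoOn_onArc φ i).monotoneOn.derivWithin_nonneg fun h0 => ?_
  have h := derivWithin_onArc_comp φ (Groupoid.inv φ) i ht
  have h1 : derivWithin (fun t : ℝ => t) (Icc 0 (arcLen p i)) t = 1 :=
    (hasDerivWithinAt_id t _).derivWithin (uniqueDiffOn_arc p i t ht)
  rw [← h0, mul_zero, Groupoid.comp_inv, derivWithin_congr (f := fun t => t)
    (fun s hs => onArc_id hs) (onArc_id ht), h1] at h
  exact one_ne_zero h

/-- The logarithm of the derivative `φ_x` on the arc `[p_i, p_{i+1}]`, up to its end points. -/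
def arcLogDeriv (φ : p ⟶ q) (i : Fin n) (t : ℝ) : ℝ :=
  Real.log (derivWithin (onArc φ i) (Icc 0 (arcLen p i)) t)

theorem contDiffOn_arcLogDeriv (φ : p ⟶ q) (i : Fin n) :
    ContDiffOn ℝ ∞ (arcLogDeriv φ i) (Icc 0 (arcLen p i)) :=
  ((contDiffOn_onArc φ i).derivWithin (uniqueDiffOn_arc p i) (by simp)).log
    fun _ ht => (derivWithin_onArc_pos φ i ht).ne'

theorem arcLogDeriv_comp (ψ : p ⟶ q) (φ : q ⟶ r) (i : Fin n) {t : ℝ}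
    (ht : t ∈ Icc 0 (arcLen p i)) :
    arcLogDeriv (ψ ≫ φ) i t = arcLogDeriv φ i (onArc ψ i t) + arcLogDeriv ψ i t := by
  rw [arcLogDeriv, derivWithin_onArc_comp ψ φ i ht, Real.log_mul
    (derivWithin_onArc_pos φ i (mapsTo_onArc ψ i ht)).ne' (derivWithin_onArc_pos ψ i ht).ne']
  rfl

theorem hasDerivWithinAt_arcLogDeriv (φ : p ⟶ q) (i : Fin n) {t : ℝ}
    (ht : t ∈ Icc 0 (arcLen p i)) :
    HasDerivWithinAt (arcLogDeriv φ i) (derivWithin (arcLogDeriv φ i) (Icc 0 (arcLen p i)) t)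
      (Icc 0 (arcLen p i)) t :=
  ((contDiffOn_arcLogDeriv φ i).differentiableOn (by simp) t ht).hasDerivWithinAt

theorem continuousOn_derivWithin_arcLogDeriv (φ : p ⟶ q) (i : Fin n) :
    ContinuousOn (derivWithin (arcLogDeriv φ i) (Icc 0 (arcLen p i))) (Icc 0 (arcLen p i)) :=
  (contDiffOn_arcLogDeriv φ i).continuousOn_derivWithin (uniqueDiffOn_arc p i) (by simp)

theorem continuousOn_arcLogDeriv_comp_onArc (φ : q ⟶ r) (ψ : p ⟶ q) (i : Fin n) :
    ContinuousOn (fun t => arcLogDeriv φ i (onArc ψ i t)) (Icc 0 (arcLen p i)) :=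
  (contDiffOn_arcLogDeriv φ i).continuousOn.comp (contDiffOn_onArc ψ i).continuousOn
    (mapsTo_onArc ψ i)

theorem arcLogDeriv_eq_log_deriv (φ : p ⟶ q) (i : Fin n) {t : ℝ} (ht : t ∈ Ioo 0 (arcLen p i)) :
    arcLogDeriv φ i t = Real.log (deriv (onArc φ i) t) := by
  rw [arcLogDeriv, derivWithin_of_mem_nhds (Icc_mem_nhds ht.1 ht.2)]

/-- Two-sided and one-sided derivatives agree in the interior of the arc, and the end points do not
affect the integral. The one-sided form is continuous up to the ends. -/
theorem bottCocycle_eq (φ : q ⟶ r) (ψ : p ⟶ q) (i : Fin n) :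
    bottCocycle n φ ψ i = ∫ t in (0 : ℝ)..(arcLen p i),
      arcLogDeriv φ i (onArc ψ i t) * derivWithin (arcLogDeriv ψ i) (Icc 0 (arcLen p i)) t := by
  refine intervalIntegral.integral_congr_Ioo_of_le (arcLen_pos p i).le fun t ht => ?_
  rw [arcLogDeriv_eq_log_deriv φ i (onArc_mem_Ioo ψ i ht),
    derivWithin_of_mem_nhds (Icc_mem_nhds ht.1 ht.2)]
  congr 1
  refine Filter.EventuallyEq.deriv_eq ?_
  filter_upwards [isOpen_Ioo.mem_nhds ht] with s hs
  exact (arcLogDeriv_eq_log_deriv ψ i hs).symm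

theorem derivWithin_arcLogDeriv_comp (ψ : p ⟶ q) (φ : q ⟶ r) (i : Fin n) {t : ℝ}
    (ht : t ∈ Icc 0 (arcLen p i)) :
    derivWithin (arcLogDeriv (ψ ≫ φ) i) (Icc 0 (arcLen p i)) t =
      derivWithin (arcLogDeriv φ i) (Icc 0 (arcLen q i)) (onArc ψ i t) *
        derivWithin (onArc ψ i) (Icc 0 (arcLen p i)) t +
      derivWithin (arcLogDeriv ψ i) (Icc 0 (arcLen p i)) t := by
  have h := ((hasDerivWithinAt_arcLogDeriv φ i (mapsTo_onArc ψ i ht)).comp t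
    (hasDerivWithinAt_onArc ψ i ht) (mapsTo_onArc ψ i)).add (hasDerivWithinAt_arcLogDeriv ψ i ht)
  refine HasDerivWithinAt.derivWithin ?_ (uniqueDiffOn_arc p i t ht)
  exact h.congr (fun s hs => arcLogDeriv_comp ψ φ i hs) (arcLogDeriv_comp ψ φ i ht)

/-- Change of variables along a broken diffeomorphism. -/
theorem integral_comp_onArc (η : p ⟶ q) (i : Fin n) {g : ℝ → ℝ}
    (hg : ContinuousOn g (Icc 0 (arcLen q i))) :
    ∫ y in (0 : ℝ)..(arcLen q i), g y = ∫ t in (0 : ℝ)..(arcLen p i),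
      g (onArc η i t) * derivWithin (onArc η i) (Icc 0 (arcLen p i)) t := by
  have h0 := (arcLen_pos p i).le
  have hI : uIcc 0 (arcLen p i) = Icc 0 (arcLen p i) := uIcc_of_le h0
  have hc := (contDiffOn_onArc η i).continuousOn
  have hs : onArc η i '' Icc 0 (arcLen p i) ⊆ Icc 0 (arcLen q i) := (mapsTo_onArc η i).image_subset
  have h := intervalIntegral.integral_comp_mul_deriv''' (a := 0) (b := arcLen p i)
    (f := onArc η i) (f' := derivWithin (onArc η i) (Icc 0 (arcLen p i))) (g := g)
    (by rwa [hI]) (fun t ht => ?_) (hg.mono ?_) (hg.integrableOn_Icc.mono_set (by rwa [hI])) ?_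
  · rw [onArc_zero, onArc_arcLen] at h
    exact h.symm
  · rw [min_eq_left h0, max_eq_right h0] at ht
    exact ((hasDerivWithinAt_onArc η i (Ioo_subset_Icc_self ht)).hasDerivAt
      (Icc_mem_nhds ht.1 ht.2)).hasDerivWithinAt
  · rw [min_eq_left h0, max_eq_right h0]
    exact (image_mono Ioo_subset_Icc_self).trans hs
  · rw [hI]
    exact ((hg.comp hc (mapsTo_onArc η i)).mul
      ((contDiffOn_onArc η i).continuousOn_derivWithin (uniqueDiffOn_arc p i) (by simp))
      ).integrableOn_Icc

theorem isTwoCocycle_bottCocycle (n : ℕ) [NeZero n] : IsTwoCocycle (bottCocycle n) := by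
  intro a b c d φ ψ η
  funext i
  simp only [Pi.add_apply, bottCocycle_eq]
  have h0 := (arcLen_pos a i).le
  have hφ := continuousOn_arcLogDeriv_comp_onArc φ (η ≫ ψ) i
  have hψ := continuousOn_arcLogDeriv_comp_onArc ψ η i
  have dη := continuousOn_derivWithin_arcLogDeriv η i
  have hc := (continuousOn_arcLogDeriv_comp_onArc φ ψ i).mul
    (continuousOn_derivWithin_arcLogDeriv ψ i)
  -- χ(φ, ψ) is an integral over an arc of `b`; moved to `a` along η, it can be compared pointwise
  -- with the other three.
  rw [integral_comp_onArc η i (g := fun t => arcLogDeriv φ i (onArc ψ i t) *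
      derivWithin (arcLogDeriv ψ i) (Icc 0 (arcLen b i)) t) hc,
    ← intervalIntegral.integral_add, ← intervalIntegral.integral_add]
  · refine intervalIntegral.integral_congr fun t ht => ?_
    rw [uIcc_of_le h0] at ht
    rw [derivWithin_arcLogDeriv_comp η ψ i ht, arcLogDeriv_comp ψ φ i (mapsTo_onArc η i ht),
      onArc_comp]
    ring
  all_goals refine ContinuousOn.intervalIntegrable_of_Icc h0 ?_
  · exact (continuousOn_arcLogDeriv_comp_onArc (ψ ≫ φ) η i).mul dη
  · exact hc.comp (contDiffOn_onArc η i).continuousOn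
      (mapsTo_onArc η i) |>.mul
      ((contDiffOn_onArc η i).continuousOn_derivWithin (uniqueDiffOn_arc a i) (by simp))
  · exact hφ.mul (continuousOn_derivWithin_arcLogDeriv (η ≫ ψ) i)
  · exact hψ.mul dη

end Arcs

/-! ### Smoothness of the cocycle -/

/-- The lifts differ by less than 1, so if their images in the circle agree, their integer
difference is 0. -/
theorem BreakPoints.pt_injective {n : ℕ} (p : BreakPoints n) : Function.Injective p.pt := by
  obtain ⟨x, hx, hx1, hxp⟩ := p.cyclic
  intro i j hij
  rw [← hxp, ← hxp, ← sub_eq_zero, ← AddCircle.coe_sub, AddCircle.coe_eq_zero_iff] at hij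
  obtain ⟨m, hm⟩ := hij
  have h1 := hx1 i j
  have h2 := hx1 j i
  rw [zsmul_eq_mul, mul_one] at hm
  have h3 : (m : ℝ) < 1 := by linarith
  have h4 : (-1 : ℝ) < m := by linarith
  have h5 : m < 1 := by exact_mod_cast h3
  have h6 : -1 < m := by exact_mod_cast h4
  obtain rfl : m = 0 := by omega
  exact hx.injective (by push_cast at hm; linarith)

theorem contDiff_arcLen {k : ℕ} {p : (Fin k → ℝ) → BreakPoints n}
    (hp : ∀ i, IsSmoothCircleFamily fun τ => (p τ).pt i) (i : Fin n) :
    ContDiff ℝ ∞ fun τ => arcLen (p τ) i := by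
  -- This is the case n = 1: the arc is the whole circle, of constant length.
  by_cases hi : i + 1 = i
  · simp only [arcLen, hi, sub_self]
    exact contDiff_const
  obtain ⟨a, ha, hap⟩ := hp i
  obtain ⟨b, hb, hbp⟩ := hp (i + 1)
  have hl : ∀ τ, arcLen (p τ) i = posRep ((b τ - a τ : ℝ) : UnitAddCircle) := fun τ => by
    rw [arcLen, AddCircle.coe_sub, hap, hbp]
  have hrep : ∀ (m : ℤ) (t : ℝ), t ∈ Ioo (m : ℝ) (m + 1) →
      posRep (t : UnitAddCircle) = t - m := by
    intro m t ht
    have h0 : ((m : ℝ) : UnitAddCircle) = 0 := by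
      rw [AddCircle.coe_eq_zero_iff]
      exact ⟨m, by simp⟩
    have h1 : ((t - m : ℝ) : UnitAddCircle) = t := by rw [AddCircle.coe_sub, h0, sub_zero]
    rw [← h1, posRep_coe ⟨by linarith [ht.1], by linarith [ht.2]⟩]
  rw [contDiff_iff_contDiffAt]
  intro τ
  -- An integral difference of the lifts would make two distinct break points coincide. Hence the
  -- floor is locally constant, and the arc length is locally the difference minus a constant.
  have hne : (b τ - a τ) ≠ (⌊b τ - a τ⌋ : ℝ) := by
    intro h
    refine hi ((p τ).pt_injective ?_)
    change (fun τ => (p τ).pt (i + 1)) τ = (fun τ => (p τ).pt i) τ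
    rw [← hap, ← hbp, ← sub_eq_zero, ← AddCircle.coe_sub, AddCircle.coe_eq_zero_iff]
    exact ⟨⌊b τ - a τ⌋, by rw [h]; simp⟩
  have hmem : b τ - a τ ∈ Ioo (⌊b τ - a τ⌋ : ℝ) (⌊b τ - a τ⌋ + 1) :=
    ⟨lt_of_le_of_ne (Int.floor_le _) hne.symm, Int.lt_floor_add_one _⟩
  have hs : ContDiff ℝ ∞ fun τ => b τ - a τ := hb.sub ha
  refine ((hs.sub (contDiff_const (c := (⌊b τ - a τ⌋ : ℝ)))).contDiffAt).congr_of_eventuallyEq ?_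
  filter_upwards [hs.continuous.continuousAt (isOpen_Ioo.mem_nhds hmem)] with σ hσ
  rw [hl, hrep _ _ hσ]

theorem derivWithin_comp_mul_left_Icc {f : ℝ → ℝ} {L s : ℝ} (hL : 0 < L) (hs : s ∈ Icc (0 : ℝ) 1)
    (hf : DifferentiableOn ℝ f (Icc 0 L)) :
    derivWithin (fun s => f (L * s)) (Icc 0 1) s = L * derivWithin f (Icc 0 L) (L * s) := by
  have hm : MapsTo (fun s : ℝ => L * s) (Icc 0 1) (Icc 0 L) := fun t ht =>
    ⟨mul_nonneg hL.le ht.1, mul_le_of_le_one_right hL.le ht.2⟩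
  have h := (hf _ (hm hs)).hasDerivWithinAt.comp s
    (((hasDerivAt_id' s).const_mul L).hasDerivWithinAt (s := Icc 0 1)) hm
  rw [mul_one, mul_comm] at h
  exact h.derivWithin (uniqueDiffOn_Icc one_pos s hs)

theorem mul_mem_arc {p : BreakPoints n} {i : Fin n} {s : ℝ} (hs : s ∈ Icc (0 : ℝ) 1) :
    arcLen p i * s ∈ Icc 0 (arcLen p i) :=
  ⟨mul_nonneg (arcLen_pos p i).le hs.1, mul_le_of_le_one_right (arcLen_pos p i).le hs.2⟩

namespace IsSmoothFamily

variable {k : ℕ} {p q : (Fin k → ℝ) → BreakPoints n} {φ : ∀ τ, p τ ⟶ q τ}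

theorem contDiffOn_strip_onArc (hφ : IsSmoothFamily φ) (i : Fin n) :
    ContDiffOn ℝ ∞ (fun z : (Fin k → ℝ) × ℝ => onArc (φ z.1) i (arcLen (p z.1) i * z.2))
      (univ ×ˢ Icc (0 : ℝ) 1) := by
  have hl := contDiff_arcLen hφ.source i
  exact (hφ.arcs i).comp (f := fun z : (Fin k → ℝ) × ℝ => (z.1, arcLen (p z.1) i * z.2))
    (contDiff_fst.prodMk ((hl.comp contDiff_fst).mul contDiff_snd)).contDiffOn
    fun z hz => mul_mem_arc hz.2

theorem contDiffOn_strip_arcLogDeriv (hφ : IsSmoothFamily φ) (i : Fin n) :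
    ContDiffOn ℝ ∞ (fun z : (Fin k → ℝ) × ℝ => arcLogDeriv (φ z.1) i (arcLen (p z.1) i * z.2))
      (univ ×ˢ Icc (0 : ℝ) 1) := by
  have hl : ContDiff ℝ ∞ fun z : (Fin k → ℝ) × ℝ => arcLen (p z.1) i :=
    (contDiff_arcLen hφ.source i).comp contDiff_fst
  have hd : ∀ z : (Fin k → ℝ) × ℝ, z ∈ (univ : Set (Fin k → ℝ)) ×ˢ Icc (0 : ℝ) 1 →
      derivWithin (fun s => onArc (φ z.1) i (arcLen (p z.1) i * s)) (Icc 0 1) z.2 =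
        arcLen (p z.1) i *
          derivWithin (onArc (φ z.1) i) (Icc 0 (arcLen (p z.1) i)) (arcLen (p z.1) i * z.2) :=
    fun z hz => derivWithin_comp_mul_left_Icc (arcLen_pos _ _) hz.2
      ((contDiffOn_onArc _ i).differentiableOn (by simp))
  refine (((contDiffOn_strip_derivWithin (hφ.contDiffOn_strip_onArc i)).div hl.contDiffOn
    fun z _ => (arcLen_pos _ _).ne').log fun z hz => ?_).congr fun z hz => ?_
  · rw [Pi.div_apply, hd z hz, mul_div_cancel_left₀ _ (arcLen_pos _ _).ne']
    exact (derivWithin_onArc_pos _ i (mul_mem_arc hz.2)).ne'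
  · rw [Pi.div_apply, hd z hz, mul_div_cancel_left₀ _ (arcLen_pos _ _).ne', arcLogDeriv]

end IsSmoothFamily

theorem isSmoothTwoCochain_bottCocycle (n : ℕ) [NeZero n] :
    IsSmoothTwoCochain (bottCocycle n) := by
  intro k p q r φ ψ hφ hψ
  rw [contDiff_pi]
  intro i
  have hlq : ContDiff ℝ ∞ fun z : (Fin k → ℝ) × ℝ => arcLen (q z.1) i :=
    (contDiff_arcLen hψ.target i).comp contDiff_fst
  -- Multiplying and dividing by the length of the target arc of ψ puts the argument of ℓ(φ) in the
  -- rescaled form for which smoothness on the strip is known.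
  have h : ∀ τ, bottCocycle n (φ τ) (ψ τ) i = ∫ s in (0 : ℝ)..1,
      arcLogDeriv (φ τ) i
        (arcLen (q τ) i * (onArc (ψ τ) i (arcLen (p τ) i * s) / arcLen (q τ) i)) *
      derivWithin (fun s => arcLogDeriv (ψ τ) i (arcLen (p τ) i * s)) (Icc 0 1) s := by
    intro τ
    have h1 := intervalIntegral.mul_integral_comp_mul_left (a := 0) (b := 1)
      (f := fun t => arcLogDeriv (φ τ) i (onArc (ψ τ) i t) *
        derivWithin (arcLogDeriv (ψ τ) i) (Icc 0 (arcLen (p τ) i)) t) (arcLen (p τ) i)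
    rw [mul_zero, mul_one] at h1
    rw [bottCocycle_eq, ← h1, ← intervalIntegral.integral_const_mul]
    refine intervalIntegral.integral_congr fun s hs => ?_
    rw [uIcc_of_le zero_le_one] at hs
    rw [mul_div_cancel₀ _ (arcLen_pos (q τ) i).ne', derivWithin_comp_mul_left_Icc
      (arcLen_pos _ _) hs ((contDiffOn_arcLogDeriv _ i).differentiableOn (by simp))]
    ring
  simp_rw [h]
  refine contDiff_integral_strip (f := fun z : (Fin k → ℝ) × ℝ => arcLogDeriv (φ z.1) i
    (arcLen (q z.1) i * (onArc (ψ z.1) i (arcLen (p z.1) i * z.2) / arcLen (q z.1) i)) *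
      derivWithin (fun s => arcLogDeriv (ψ z.1) i (arcLen (p z.1) i * s)) (Icc 0 1) z.2) ?_
  refine ContDiffOn.mul ?_ (contDiffOn_strip_derivWithin (hψ.contDiffOn_strip_arcLogDeriv i))
  refine (hφ.contDiffOn_strip_arcLogDeriv i).comp (f := fun z : (Fin k → ℝ) × ℝ =>
    (z.1, onArc (ψ z.1) i (arcLen (p z.1) i * z.2) / arcLen (q z.1) i)) ?_ ?_
  · exact contDiff_fst.contDiffOn.prodMk ((hψ.contDiffOn_strip_onArc i).div hlq.contDiffOn
      fun z _ => (arcLen_pos _ _).ne')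
  · intro z hz
    have hm := mapsTo_onArc (ψ z.1) i (mul_mem_arc (p := p z.1) (i := i) hz.2)
    exact ⟨mem_univ _, div_nonneg hm.1 (arcLen_pos _ _).le,
      div_le_one_of_le₀ hm.2 (arcLen_pos _ _).le⟩

/-! ### Diffeomorphisms of an interval with prescribed logarithmic derivative -/

/-- The diffeomorphism of `[0, L]` whose logarithmic derivative is `g` up to a constant. -/
def stretch (L : ℝ) (g : ℝ → ℝ) (t : ℝ) : ℝ :=
  L / (∫ s in (0 : ℝ)..L, Real.exp (g s)) * ∫ s in (0 : ℝ)..t, Real.exp (g s)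

section Stretch

variable {L : ℝ} {g h : ℝ → ℝ}

theorem integral_exp_pos (hL : 0 < L) (hg : Continuous g) :
    0 < ∫ s in (0 : ℝ)..L, Real.exp (g s) :=
  intervalIntegral.intervalIntegral_pos_of_pos
    ((Real.continuous_exp.comp hg).intervalIntegrable _ _) (fun _ => Real.exp_pos _) hL

theorem hasDerivAt_stretch (L : ℝ) (hg : Continuous g) (t : ℝ) :
    HasDerivAt (stretch L g) (L / (∫ s in (0 : ℝ)..L, Real.exp (g s)) * Real.exp (g t)) t :=
  ((Real.continuous_exp.comp hg).integral_hasStrictDerivAt 0 t).hasDerivAt.const_mul _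

theorem stretch_zero : stretch L g 0 = 0 := by simp [stretch]

theorem stretch_self (hL : 0 < L) (hg : Continuous g) : stretch L g L = L :=
  div_mul_cancel₀ _ (integral_exp_pos hL hg).ne'

theorem strictMono_stretch (hL : 0 < L) (hg : Continuous g) : StrictMono (stretch L g) :=
  strictMono_of_deriv_pos fun t => by
    rw [(hasDerivAt_stretch L hg t).deriv]
    exact mul_pos (div_pos hL (integral_exp_pos hL hg)) (Real.exp_pos _)

theorem continuous_stretch (hg : Continuous g) : Continuous (stretch L g) :=
  continuous_iff_continuousAt.2 fun t => (hasDerivAt_stretch L hg t).continuousAt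

theorem contDiff_stretch_family {H : Type} [NormedAddCommGroup H] [NormedSpace ℝ H] [ProperSpace H]
    (hL : 0 < L) {G : H × ℝ → ℝ} (hG : ContDiff ℝ ∞ G) :
    ContDiff ℝ ∞ fun z : H × ℝ => stretch L (fun t => G (z.1, t)) z.2 := by
  have he : ContDiff ℝ ∞ fun z => Real.exp (G z) := Real.contDiff_exp.comp hG
  refine (contDiff_const.div ((contDiff_parametric_integral he 0 L).comp contDiff_fst)
    fun z => ?_).mul (contDiff_parametric_primitive he)
  exact (integral_exp_pos hL (hG.continuous.comp (by fun_prop))).ne'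

theorem contDiff_stretch (hL : 0 < L) (hg : ContDiff ℝ ∞ g) : ContDiff ℝ ∞ (stretch L g) :=
  (contDiff_stretch_family (H := ℝ) (G := fun z => g z.2) hL (by fun_prop)).comp
    (f := fun t : ℝ => ((0 : ℝ), t)) (by fun_prop)

/-- Both sides have the same logarithmic derivative up to a constant and fix 0 and `L`, which
determines them. The proof exhibits the composite, divided by `a * b`, as the primitive of the
exponential. -/
theorem stretch_stretch (hL : 0 < L) (hg : Continuous g) (hh : Continuous h) (t : ℝ) :
    stretch L g (stretch L h t) = stretch L (fun s => g (stretch L h s) + h s) t := by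
  set a := L / (∫ s in (0 : ℝ)..L, Real.exp (g s)) with ha
  set b := L / (∫ s in (0 : ℝ)..L, Real.exp (h s)) with hb
  have ha0 : 0 < a := div_pos hL (integral_exp_pos hL hg)
  have hb0 : 0 < b := div_pos hL (integral_exp_pos hL hh)
  have hk : Continuous fun s => g (stretch L h s) + h s :=
    (hg.comp (continuous_stretch hh)).add hh
  have hF : ∀ t, ∫ s in (0 : ℝ)..t, Real.exp (g (stretch L h s) + h s) =
      (a * b)⁻¹ * stretch L g (stretch L h t) := by
    intro t
    rw [intervalIntegral.integral_eq_sub_of_hasDerivAt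
      (f := fun s => (a * b)⁻¹ * stretch L g (stretch L h s))]
    · simp only [stretch_zero, mul_zero, sub_zero]
    · intro s _
      have := ((hasDerivAt_stretch L hg (stretch L h s)).comp s
        (hasDerivAt_stretch L hh s)).const_mul (a * b)⁻¹
      refine this.congr_deriv ?_
      rw [← ha, ← hb, Real.exp_add]
      field_simp
    · exact (Real.continuous_exp.comp hk).intervalIntegrable _ _
  rw [stretch.eq_1 L (fun s => g (stretch L h s) + h s), hF, hF, stretch_self hL hh,
    stretch_self hL hg]
  field_simp

/-- The map need not be onto ℝ, but its derivative never vanishes, so it is an open embedding with a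
smooth inverse on its image, which contains [0, L]. -/
theorem exists_contDiffOn_inverse_stretch (hL : 0 < L) (hg : ContDiff ℝ ∞ g) :
    ∃ f : ℝ → ℝ, ContDiffOn ℝ ∞ f (Icc 0 L) ∧ ∀ t, f (stretch L g t) = t := by
  have hm := strictMono_stretch hL hg.continuous
  have hc := continuous_stretch (L := L) hg.continuous
  have ho : Topology.IsOpenEmbedding (stretch L g) :=
    .of_continuous_injective_isOpenMap hc hm.injective <|
      isOpenMap_of_hasStrictDerivAt (fun t => (contDiff_stretch hL hg).contDiffAt.hasStrictDerivAt'
        (hasDerivAt_stretch L hg.continuous t) (by simp)) fun t =>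
        (mul_pos (div_pos hL (integral_exp_pos hL hg.continuous)) (Real.exp_pos (g t))).ne'
  let e := ho.toOpenPartialHomeomorph
  refine ⟨e.symm, ?_, fun t => e.left_inv (mem_univ t)⟩
  intro y hy
  obtain ⟨t, ht, rfl⟩ : y ∈ stretch L g '' Icc 0 L := by
    have := intermediate_value_Icc hL.le hc.continuousOn
    rw [stretch_zero, stretch_self hL hg.continuous] at this
    exact this hy
  refine (e.contDiffAt_symm_deriv (a := stretch L g t) (mul_pos (div_pos hL
    (integral_exp_pos hL hg.continuous)) (Real.exp_pos (g t))).ne' ?_ ?_ ?_).contDiffWithinAt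
  · exact ⟨t, mem_univ _, rfl⟩
  · have h1 : e.symm (stretch L g t) = t := e.left_inv (mem_univ t)
    rw [h1]
    exact hasDerivAt_stretch L hg.continuous t
  · exact (contDiff_stretch hL hg).contDiffAt

/-- The extension of `stretch L g` by the identity. -/
def stretchExt (L : ℝ) (g : ℝ → ℝ) (t : ℝ) : ℝ := if t ≤ L then stretch L g t else t

theorem stretchExt_of_le {t : ℝ} (ht : t ≤ L) : stretchExt L g t = stretch L g t := if_pos ht

theorem stretchExt_of_ge (hL : 0 < L) (hg : Continuous g) {t : ℝ} (ht : L ≤ t) :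
    stretchExt L g t = t := by
  rcases ht.eq_or_lt with rfl | ht
  · rw [stretchExt_of_le le_rfl, stretch_self hL hg]
  · exact if_neg ht.not_ge

theorem strictMono_stretchExt (hL : 0 < L) (hg : Continuous g) : StrictMono (stretchExt L g) := by
  have hm := strictMono_stretch hL hg
  intro s t hst
  rcases le_total t L with ht | ht
  · rw [stretchExt_of_le ht, stretchExt_of_le (hst.le.trans ht)]
    exact hm hst
  rw [stretchExt_of_ge hL hg ht]
  rcases le_or_gt L s with hs | hs
  · rwa [stretchExt_of_ge hL hg hs]
  · rw [stretchExt_of_le hs.le]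
    exact ((hm hs).trans_eq (stretch_self hL hg)).trans_le ht

theorem continuous_stretchExt (hL : 0 < L) (hg : Continuous g) : Continuous (stretchExt L g) := by
  refine Continuous.if_le (continuous_stretch hg) continuous_id continuous_id continuous_const ?_
  rintro t rfl
  exact stretch_self hL hg

theorem stretchExt_zero (hL : 0 < L) : stretchExt L g 0 = 0 := by
  rw [stretchExt_of_le hL.le, stretch_zero]

theorem stretchExt_stretchExt (hL : 0 < L) (hg : Continuous g) (hh : Continuous h) (t : ℝ) :
    stretchExt L g (stretchExt L h t) =
      stretchExt L (fun s => g (stretch L h s) + h s) t := by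
  have hk : Continuous fun s => g (stretch L h s) + h s :=
    (hg.comp (continuous_stretch hh)).add hh
  rcases le_total t L with ht | ht
  · have h1 : stretch L h t ≤ L :=
      ((strictMono_stretch hL hh).monotone ht).trans_eq (stretch_self hL hh)
    rw [stretchExt_of_le ht, stretchExt_of_le ht, stretchExt_of_le h1, stretch_stretch hL hg hh]
  · rw [stretchExt_of_ge hL hh ht, stretchExt_of_ge hL hg ht, stretchExt_of_ge hL hk ht]

end Stretch

/-! ### Homeomorphisms of the circle from homeomorphisms of an interval -/

section Circle

/-- The map of the circle which is `σ` in the arc length coordinate measured from `b`. -/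
def circleMap (b : UnitAddCircle) (σ : ℝ → ℝ) (y : UnitAddCircle) : UnitAddCircle :=
  b + ((σ (posRep (y - b)) : ℝ) : UnitAddCircle)

variable {b : UnitAddCircle} {σ : ℝ → ℝ}

theorem circleMap_apply (h0 : σ 0 = 0) (h1 : σ 1 = 1) {t : ℝ} (ht : t ∈ Icc (0 : ℝ) 1) :
    circleMap b σ (b + (t : UnitAddCircle)) = b + ((σ t : ℝ) : UnitAddCircle) := by
  have hp : ((1 : ℝ) : UnitAddCircle) = 0 := AddCircle.coe_period 1
  rcases ht.1.eq_or_lt with rfl | h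
  -- The representative of 0 in (0, 1] is 1, so both σ 0 = 0 and σ 1 = 1 are needed at the base
  -- point.
  · have : posRep (0 : UnitAddCircle) = 1 := by rw [← hp, posRep_coe (by simp)]
    simp [circleMap, this, h0, h1, hp]
  · rw [circleMap, add_sub_cancel_left, posRep_coe ⟨h, ht.2⟩]

theorem exists_eq_add_coe (b y : UnitAddCircle) :
    ∃ t ∈ Ioc (0 : ℝ) 1, y = b + (t : UnitAddCircle) :=
  ⟨posRep (y - b), posRep_mem _, by rw [coe_posRep]; abel⟩

theorem continuous_circleMap (h0 : σ 0 = 0) (h1 : σ 1 = 1) (hc : Continuous σ) :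
    Continuous (circleMap b σ) := by
  have hp : ((1 : ℝ) : UnitAddCircle) = 0 := AddCircle.coe_period 1
  have h : Continuous (AddCircle.liftIoc (1 : ℝ) 0 fun t => ((σ t : ℝ) : UnitAddCircle)) :=
    AddCircle.liftIoc_zero_continuous (by simp [h0, h1, hp])
      ((AddCircle.continuous_mk' 1).comp hc).continuousOn
  exact continuous_const.add (h.comp (continuous_id.sub continuous_const))

theorem bijective_circleMap (h0 : σ 0 = 0) (h1 : σ 1 = 1) (hc : Continuous σ)
    (hm : StrictMono σ) : Function.Bijective (circleMap b σ) := by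
  have hI : ∀ {t}, t ∈ Ioc (0 : ℝ) 1 → σ t ∈ Ioc (0 : ℝ) 1 := fun ht =>
    ⟨h0.symm.trans_lt (hm ht.1), (hm.monotone ht.2).trans_eq h1⟩
  constructor
  · intro y z hyz
    obtain ⟨s, hs, rfl⟩ := exists_eq_add_coe b y
    obtain ⟨t, ht, rfl⟩ := exists_eq_add_coe b z
    rw [circleMap_apply h0 h1 (Ioc_subset_Icc_self hs),
      circleMap_apply h0 h1 (Ioc_subset_Icc_self ht)] at hyz
    have h := congrArg posRep (add_left_cancel hyz)
    rw [posRep_coe (hI hs), posRep_coe (hI ht)] at h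
    rw [hm.injective h]
  · intro y
    obtain ⟨s, hs, rfl⟩ := exists_eq_add_coe b y
    have := intermediate_value_Icc zero_le_one hc.continuousOn
    rw [h0, h1] at this
    obtain ⟨t, ht, rfl⟩ := this (Ioc_subset_Icc_self hs)
    exact ⟨_, circleMap_apply h0 h1 ht⟩

/-- `circleMap b σ` as a homeomorphism. -/
def circleHomeo (b : UnitAddCircle) (h0 : σ 0 = 0) (h1 : σ 1 = 1) (hc : Continuous σ)
    (hm : StrictMono σ) : UnitAddCircle ≃ₜ UnitAddCircle :=
  (continuous_circleMap h0 h1 hc).homeoOfEquivCompactToT2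
    (f := Equiv.ofBijective (circleMap b σ) (bijective_circleMap h0 h1 hc hm))

/-- The bound d + t ≤ 1 says that the segment does not pass the base point `b`, so no wrap-around
occurs. -/
theorem arcMap_circleMap (h0 : σ 0 = 0) (h1 : σ 1 = 1) (hm : StrictMono σ) {d t : ℝ}
    (hd : 0 ≤ d) (ht : 0 ≤ t) (hdt : d + t ≤ 1) :
    arcMap (circleMap b σ) (b + (d : UnitAddCircle)) t = σ (d + t) - σ d := by
  rcases ht.eq_or_lt with rfl | ht
  · rw [arcMap_of_nonpos _ _ le_rfl, add_zero, sub_self]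
  · rw [arcMap, if_neg ht.not_ge, add_assoc, ← AddCircle.coe_add,
      circleMap_apply h0 h1 ⟨by linarith, hdt⟩, circleMap_apply h0 h1 ⟨hd, by linarith⟩,
      add_sub_add_left_eq_sub, ← AddCircle.coe_sub, posRep_coe]
    have h2 := hm.monotone hdt
    have h3 := hm.monotone hd
    exact ⟨sub_pos.2 (hm (by linarith)), by linarith⟩

end Circle

/-! ### Arrows supported in one arc between equally spaced points -/

section EqualPoints

variable (n)

theorem inv_natCast_pos : 0 < (n : ℝ)⁻¹ :=
  inv_pos.2 (Nat.cast_pos.2 (Nat.pos_of_ne_zero (NeZero.ne n)))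

theorem coe_mod_div (m : ℕ) :
    ((((m % n : ℕ) : ℝ) / n : ℝ) : UnitAddCircle) = ((m / n : ℝ) : UnitAddCircle) := by
  have hn : (n : ℝ) ≠ 0 := Nat.cast_ne_zero.2 (NeZero.ne n)
  have h : (m : ℝ) / n = ((m % n : ℕ) : ℝ) / n + ((m / n : ℕ) : ℝ) := by
    have h1 : ((n * (m / n) + m % n : ℕ) : ℝ) = m := by rw [Nat.div_add_mod]
    rw [← h1]
    push_cast
    field_simp
    ring
  have h0 : (((m / n : ℕ) : ℝ) : UnitAddCircle) = 0 := by
    rw [AddCircle.coe_eq_zero_iff]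
    exact ⟨((m / n : ℕ) : ℤ), by rw [zsmul_eq_mul, mul_one, Int.cast_natCast]⟩
  rw [h, AddCircle.coe_add, h0, add_zero]

/-- The points `j / n`. -/
def equalPoints : BreakPoints n where
  pt j := ((j / n : ℝ) : UnitAddCircle)
  cyclic := by
    have hn : (0 : ℝ) < n := Nat.cast_pos.2 (Nat.pos_of_ne_zero (NeZero.ne n))
    refine ⟨fun j => j / n, fun i j hij => ?_, fun i j => ?_, fun j => rfl⟩
    · exact div_lt_div_of_pos_right (Nat.cast_lt.2 hij) hn
    · have h1 : (i : ℝ) / n < 1 := (div_lt_one hn).2 (Nat.cast_lt.2 i.2)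
      have h2 : (0 : ℝ) ≤ (j : ℝ) / n := by positivity
      linarith

variable {n}

theorem equalPoints_pt_add (i j : Fin n) :
    (equalPoints n).pt (i + j) = (equalPoints n).pt i + (equalPoints n).pt j := by
  simp only [equalPoints]
  rw [Fin.val_add, coe_mod_div, ← AddCircle.coe_add]
  push_cast
  rw [add_div]

theorem arcLen_equalPoints (i : Fin n) : arcLen (equalPoints n) i = (n : ℝ)⁻¹ := by
  have h1 : (equalPoints n).pt 1 = (((n : ℝ)⁻¹ : ℝ) : UnitAddCircle) := by
    simp only [equalPoints]
    rw [Fin.val_one', coe_mod_div]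
    simp
  rw [arcLen, equalPoints_pt_add, add_sub_cancel_left, h1, posRep_coe]
  exact ⟨inv_natCast_pos n,
    inv_le_one_of_one_le₀ (Nat.one_le_cast.2 (Nat.pos_of_ne_zero (NeZero.ne n)))⟩

/-- Seen from the i-th point, every other arc lies in [1/n, 1], where `stretchExt` is the identity.
-/
theorem exists_equalPoints_pt_eq (i j : Fin n) (hij : j ≠ i) :
    ∃ d : ℝ, (n : ℝ)⁻¹ ≤ d ∧ d + (n : ℝ)⁻¹ ≤ 1 ∧
      (equalPoints n).pt j = (equalPoints n).pt i + (d : UnitAddCircle) := by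
  have hn : (0 : ℝ) < n := Nat.cast_pos.2 (Nat.pos_of_ne_zero (NeZero.ne n))
  refine ⟨((j - i : Fin n) : ℕ) / n, ?_, ?_, ?_⟩
  · rw [inv_eq_one_div]
    refine div_le_div_of_nonneg_right ?_ hn.le
    rw [Nat.one_le_cast, Nat.one_le_iff_ne_zero]
    exact Fin.val_ne_zero_iff.2 (sub_ne_zero.2 hij)
  · rw [inv_eq_one_div, ← add_div, div_le_one hn]
    exact_mod_cast (j - i).2
  · have := equalPoints_pt_add i (j - i)
    rwa [add_sub_cancel] at this

end EqualPoints

/-! ### Arrows moving a single arc, and the cocycle on them. -/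

section ArcArrow

variable {g h : ℝ → ℝ}

theorem stretchExt_one (hg : Continuous g) : stretchExt (n : ℝ)⁻¹ g 1 = 1 :=
  stretchExt_of_ge (inv_natCast_pos n) hg
    (inv_le_one_of_one_le₀ (Nat.one_le_cast.2 (Nat.pos_of_ne_zero (NeZero.ne n))))

/-- The homeomorphism of the circle which is `stretch` on the `i`-th arc between the points `j / n`
and the identity on the other arcs. -/
def arcHomeo (i : Fin n) (hg : Continuous g) : UnitAddCircle ≃ₜ UnitAddCircle :=
  circleHomeo ((equalPoints n).pt i) (stretchExt_zero (g := g) (inv_natCast_pos n))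
    (stretchExt_one hg) (continuous_stretchExt (inv_natCast_pos n) hg)
    (strictMono_stretchExt (inv_natCast_pos n) hg)

theorem coe_arcHomeo (i : Fin n) (hg : Continuous g) :
    ⇑(arcHomeo i hg) = circleMap ((equalPoints n).pt i) (stretchExt (n : ℝ)⁻¹ g) := rfl

theorem arcHomeo_apply (i : Fin n) (hg : Continuous g) {t : ℝ} (ht : t ∈ Icc (0 : ℝ) 1) :
    arcHomeo i hg ((equalPoints n).pt i + (t : UnitAddCircle)) =
      (equalPoints n).pt i + ((stretchExt (n : ℝ)⁻¹ g t : ℝ) : UnitAddCircle) :=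
  circleMap_apply (b := (equalPoints n).pt i) (stretchExt_zero (g := g) (inv_natCast_pos n))
    (stretchExt_one hg) ht

theorem arcHomeo_pt (i j : Fin n) (hg : Continuous g) :
    arcHomeo i hg ((equalPoints n).pt j) = (equalPoints n).pt j := by
  rcases eq_or_ne j i with rfl | hij
  · have h1 := arcHomeo_apply j hg (left_mem_Icc.2 zero_le_one)
    rwa [stretchExt_zero (inv_natCast_pos n), AddCircle.coe_zero, add_zero] at h1
  · obtain ⟨d, hd, hd1, hj⟩ := exists_equalPoints_pt_eq i j hij
    have hn := inv_natCast_pos n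
    rw [hj, arcHomeo_apply i hg ⟨by linarith, by linarith⟩, stretchExt_of_ge hn hg hd]

theorem arcMap_arcHomeo_self (i : Fin n) (hg : Continuous g) {t : ℝ}
    (ht : t ∈ Icc 0 (n : ℝ)⁻¹) :
    arcMap (arcHomeo i hg) ((equalPoints n).pt i) t = stretch (n : ℝ)⁻¹ g t := by
  have hn := inv_natCast_pos n
  have hn1 : (n : ℝ)⁻¹ ≤ 1 :=
    inv_le_one_of_one_le₀ (Nat.one_le_cast.2 (Nat.pos_of_ne_zero (NeZero.ne n)))
  have h1 := arcMap_circleMap (b := (equalPoints n).pt i) (stretchExt_zero (g := g) hn)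
    (stretchExt_one hg) (strictMono_stretchExt hn hg) le_rfl ht.1 (by linarith [ht.2])
  rwa [AddCircle.coe_zero, add_zero, zero_add, stretchExt_zero hn, sub_zero,
    stretchExt_of_le ht.2] at h1

theorem arcMap_arcHomeo_of_ne {i j : Fin n} (hij : j ≠ i) (hg : Continuous g) {t : ℝ}
    (ht : t ∈ Icc 0 (n : ℝ)⁻¹) :
    arcMap (arcHomeo i hg) ((equalPoints n).pt j) t = t := by
  have hn := inv_natCast_pos n
  obtain ⟨d, hd, hd1, hj⟩ := exists_equalPoints_pt_eq i j hij
  have h1 := arcMap_circleMap (b := (equalPoints n).pt i) (stretchExt_zero (g := g) hn)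
    (stretchExt_one hg) (strictMono_stretchExt hn hg) (by linarith) ht.1
    (by linarith [ht.2] : d + t ≤ 1)
  rw [hj, coe_arcHomeo, h1, stretchExt_of_ge hn hg hd,
    stretchExt_of_ge hn hg (by linarith [ht.1]), add_sub_cancel_left]

theorem arcMap_symm_arcMap (Φ : UnitAddCircle ≃ₜ UnitAddCircle) {x : UnitAddCircle}
    (hx : Φ x = x) {t : ℝ} (ht : t ∈ Icc (0 : ℝ) 1) :
    arcMap Φ.symm x (arcMap Φ x t) = t := by
  have h1 := arcMap_comp Φ.symm Φ x t
  rw [Homeomorph.symm_comp_self, arcMap_id _ ht, hx] at h1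
  exact h1.symm

/-- The arrow with homeomorphism `arcHomeo`. -/
def arcArrow (i : Fin n) (hg : ContDiff ℝ ∞ g) : equalPoints n ⟶ equalPoints n :=
  BrokenDiffeo.mk (arcHomeo i hg.continuous) (fun j => arcHomeo_pt i j hg.continuous)
    (fun j => by
      rw [arcLen_equalPoints]
      rcases eq_or_ne j i with rfl | hij
      · exact (contDiff_stretch (inv_natCast_pos n) hg).contDiffOn.congr
          fun t ht => arcMap_arcHomeo_self j hg.continuous ht
      · exact contDiffOn_id.congr fun t ht => arcMap_arcHomeo_of_ne hij hg.continuous ht)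
    (fun j => by
      have hn := inv_natCast_pos n
      have hn1 : (n : ℝ)⁻¹ ≤ 1 :=
        inv_le_one_of_one_le₀ (Nat.one_le_cast.2 (Nat.pos_of_ne_zero (NeZero.ne n)))
      have hs : ∀ t ∈ Icc 0 (n : ℝ)⁻¹, arcMap (arcHomeo i hg.continuous).symm
          ((equalPoints n).pt j) (arcMap (arcHomeo i hg.continuous) ((equalPoints n).pt j) t) = t :=
        fun t ht => arcMap_symm_arcMap _ (arcHomeo_pt i j hg.continuous)
          ⟨ht.1, ht.2.trans hn1⟩
      rw [arcLen_equalPoints]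
      rcases eq_or_ne j i with rfl | hij
      · obtain ⟨f, hf, hfg⟩ := exists_contDiffOn_inverse_stretch hn hg
        refine hf.congr fun y hy => ?_
        obtain ⟨t, ht, rfl⟩ : y ∈ stretch (n : ℝ)⁻¹ g '' Icc 0 (n : ℝ)⁻¹ := by
          have := intermediate_value_Icc hn.le (continuous_stretch (L := (n : ℝ)⁻¹)
            hg.continuous).continuousOn
          rw [stretch_zero, stretch_self hn hg.continuous] at this
          exact this hy
        rw [hfg, ← arcMap_arcHomeo_self j hg.continuous ht, hs t ht]
      · refine contDiffOn_id.congr fun t ht => ?_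
        have h1 := hs t ht
        rwa [arcMap_arcHomeo_of_ne hij hg.continuous ht] at h1)

theorem onArc_arcArrow_self (i : Fin n) (hg : ContDiff ℝ ∞ g) {t : ℝ}
    (ht : t ∈ Icc 0 (n : ℝ)⁻¹) : onArc (arcArrow i hg) i t = stretch (n : ℝ)⁻¹ g t :=
  arcMap_arcHomeo_self i hg.continuous ht

theorem onArc_arcArrow_of_ne {i j : Fin n} (hij : j ≠ i) (hg : ContDiff ℝ ∞ g) {t : ℝ}
    (ht : t ∈ Icc 0 (n : ℝ)⁻¹) : onArc (arcArrow i hg) j t = t :=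
  arcMap_arcHomeo_of_ne hij hg.continuous ht

theorem contDiff_stretch_comp_add (hg : ContDiff ℝ ∞ g) (hh : ContDiff ℝ ∞ h) :
    ContDiff ℝ ∞ fun s => g (stretch (n : ℝ)⁻¹ h s) + h s :=
  (hg.comp (contDiff_stretch (inv_natCast_pos n) hh)).add hh

theorem arcArrow_comp (i : Fin n) (hg : ContDiff ℝ ∞ g) (hh : ContDiff ℝ ∞ h) :
    arcArrow i hh ≫ arcArrow i hg = arcArrow i (contDiff_stretch_comp_add (n := n) hg hh) := by
  have hn := inv_natCast_pos n
  refine BrokenDiffeo.ext (Homeomorph.ext fun y => ?_)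
  change arcHomeo i hg.continuous (arcHomeo i hh.continuous y) =
    arcHomeo i (contDiff_stretch_comp_add (n := n) hg hh).continuous y
  obtain ⟨t, ht, rfl⟩ := exists_eq_add_coe ((equalPoints n).pt i) y
  have hm : stretchExt (n : ℝ)⁻¹ h t ∈ Icc (0 : ℝ) 1 := by
    have hmono := (strictMono_stretchExt hn hh.continuous).monotone
    exact ⟨(stretchExt_zero hn).symm.trans_le (hmono ht.1.le),
      (hmono ht.2).trans_eq (stretchExt_one hh.continuous)⟩
  rw [arcHomeo_apply i _ (Ioc_subset_Icc_self ht), arcHomeo_apply i _ hm,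
    arcHomeo_apply i _ (Ioc_subset_Icc_self ht), stretchExt_stretchExt hn hg.continuous
    hh.continuous]

theorem isSmoothFamily_arcArrow (i : Fin n) {k : ℕ} {G : (Fin k → ℝ) × ℝ → ℝ}
    (hG : ContDiff ℝ ∞ G) (hGτ : ∀ τ, ContDiff ℝ ∞ fun t => G (τ, t)) :
    IsSmoothFamily fun τ => arcArrow i (hGτ τ) := by
  refine ⟨fun j => ⟨fun _ => j / n, contDiff_const, fun _ => rfl⟩,
    fun j => ⟨fun _ => j / n, contDiff_const, fun _ => rfl⟩, fun j => ?_⟩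
  rcases eq_or_ne j i with rfl | hij
  · refine (contDiff_stretch_family (inv_natCast_pos n) hG).contDiffOn.congr fun z hz => ?_
    rw [mem_ofPred_eq, arcLen_equalPoints] at hz
    exact onArc_arcArrow_self j _ hz
  · refine contDiff_snd.contDiffOn.congr fun z hz => ?_
    rw [mem_ofPred_eq, arcLen_equalPoints] at hz
    exact onArc_arcArrow_of_ne hij _ hz

theorem arcLogDeriv_arcArrow_self (i : Fin n) (hg : ContDiff ℝ ∞ g) {t : ℝ}
    (ht : t ∈ Icc 0 (n : ℝ)⁻¹) : arcLogDeriv (arcArrow i hg) i t =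
      Real.log ((n : ℝ)⁻¹ / ∫ s in (0 : ℝ)..(n : ℝ)⁻¹, Real.exp (g s)) + g t := by
  have hn := inv_natCast_pos n
  rw [arcLogDeriv, arcLen_equalPoints, ((hasDerivAt_stretch (n : ℝ)⁻¹ hg.continuous
    t).hasDerivWithinAt.congr (fun s hs => onArc_arcArrow_self i hg hs)
    (onArc_arcArrow_self i hg ht)).derivWithin (uniqueDiffOn_Icc hn t ht),
    Real.log_mul (div_pos hn (integral_exp_pos hn hg.continuous)).ne' (Real.exp_ne_zero _),
    Real.log_exp]

theorem arcLogDeriv_arcArrow_of_ne {i j : Fin n} (hij : j ≠ i) (hg : ContDiff ℝ ∞ g) {t : ℝ}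
    (ht : t ∈ Icc 0 (n : ℝ)⁻¹) : arcLogDeriv (arcArrow i hg) j t = 0 := by
  rw [arcLogDeriv, arcLen_equalPoints, ((hasDerivAt_id' t).hasDerivWithinAt.congr
    (fun s hs => onArc_arcArrow_of_ne hij hg hs) (onArc_arcArrow_of_ne hij hg ht)).derivWithin
    (uniqueDiffOn_Icc (inv_natCast_pos n) t ht), Real.log_one]

theorem stretch_mem_Icc {L : ℝ} (hL : 0 < L) (hg : Continuous g) {t : ℝ} (ht : t ∈ Icc 0 L) :
    stretch L g t ∈ Icc 0 L := by
  have hmono := (strictMono_stretch hL hg).monotone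
  exact ⟨stretch_zero.symm.trans_le (hmono ht.1), (hmono ht.2).trans_eq (stretch_self hL hg)⟩

theorem bottCocycle_arcArrow_of_ne {i j : Fin n} (hij : j ≠ i) (hg : ContDiff ℝ ∞ g)
    (hh : ContDiff ℝ ∞ h) : bottCocycle n (arcArrow i hg) (arcArrow i hh) j = 0 := by
  have hn := inv_natCast_pos n
  rw [bottCocycle_eq, arcLen_equalPoints, intervalIntegral.integral_congr (g := fun _ => 0)]
  · simp
  intro t ht
  rw [uIcc_of_le hn.le] at ht
  simp only
  rw [onArc_arcArrow_of_ne hij hh ht, arcLogDeriv_arcArrow_of_ne hij hg ht, zero_mul]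

/-- The normalising constant in ℓ(φ) contributes a multiple of ∫ h', which vanishes because `h`
agrees at the two ends. -/
theorem bottCocycle_arcArrow_self (i : Fin n) (hg : ContDiff ℝ ∞ g)
    (hh : ContDiff ℝ ∞ h) (hper : h (n : ℝ)⁻¹ = h 0) :
    bottCocycle n (arcArrow i hg) (arcArrow i hh) i =
      ∫ t in (0 : ℝ)..(n : ℝ)⁻¹, g (stretch (n : ℝ)⁻¹ h t) * deriv h t := by
  have hn := inv_natCast_pos n
  have hd : Continuous (deriv h) := hh.continuous_deriv (by simp)
  have hg' : Continuous fun t => g (stretch (n : ℝ)⁻¹ h t) :=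
    hg.continuous.comp (continuous_stretch hh.continuous)
  have hint : ∫ t in (0 : ℝ)..(n : ℝ)⁻¹, deriv h t = 0 := by
    rw [intervalIntegral.integral_deriv_eq_sub (fun t _ => hh.differentiable (by simp) t)
      (hd.intervalIntegrable _ _), hper, sub_self]
  set C := Real.log ((n : ℝ)⁻¹ / ∫ s in (0 : ℝ)..(n : ℝ)⁻¹, Real.exp (g s)) with hC
  have h1 : bottCocycle n (arcArrow i hg) (arcArrow i hh) i =
      ∫ t in (0 : ℝ)..(n : ℝ)⁻¹, (C * deriv h t + g (stretch (n : ℝ)⁻¹ h t) * deriv h t) := by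
    rw [bottCocycle_eq, arcLen_equalPoints]
    refine intervalIntegral.integral_congr fun t ht => ?_
    rw [uIcc_of_le hn.le] at ht
    have h2 : derivWithin (arcLogDeriv (arcArrow i hh) i) (Icc 0 (n : ℝ)⁻¹) t = deriv h t :=
      (((hh.differentiable (by simp) t).hasDerivAt.const_add _).hasDerivWithinAt.congr
        (fun s hs => arcLogDeriv_arcArrow_self i hh hs)
        (arcLogDeriv_arcArrow_self i hh ht)).derivWithin (uniqueDiffOn_Icc hn t ht)
    rw [h2, onArc_arcArrow_self i hh ht,
      arcLogDeriv_arcArrow_self i hg (stretch_mem_Icc hn hh.continuous ht), ← hC]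
    ring
  rw [h1, intervalIntegral.integral_add (Continuous.intervalIntegrable (by fun_prop) _ _)
    (Continuous.intervalIntegrable (by exact hg'.mul hd) _ _), intervalIntegral.integral_const_mul, hint, mul_zero,
    zero_add]

end ArcArrow

/-! ### The infinitesimal form of a coboundary -/

section Infinitesimal

open Filter Topology

/-- Both points move while their difference has order s². Strict differentiability bounds the error
by o(s²); differentiability at `x` alone would give only an error small relative to the distances of
the points from `x`. -/
theorem tendsto_sub_div_sq {E : Type*} [NormedAddCommGroup E] [NormedSpace ℝ E] {F : E → ℝ}
    {F' : E →L[ℝ] ℝ} {x e : E} (hF : HasStrictFDerivAt F F' x) {a b : ℝ → E}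
    (ha : Tendsto a (𝓝[≠] 0) (𝓝 x)) (hb : Tendsto b (𝓝[≠] 0) (𝓝 x))
    (hab : ∀ s, a s - b s = s ^ 2 • e) :
    Tendsto (fun s => (F (a s) - F (b s)) / s ^ 2) (𝓝[≠] 0) (𝓝 (F' e)) := by
  have h1 := hF.isLittleO.comp_tendsto (ha.prodMk_nhds hb)
  have h2 : (fun s => F (a s) - F (b s) - s ^ 2 * F' e) =o[𝓝[≠] 0] fun s : ℝ => s ^ 2 := by
    refine (h1.congr (fun s => ?_) (fun s => ?_)).trans_isBigO
      (Asymptotics.IsBigO.of_bound (f := fun s : ℝ => s ^ 2 • e) (g := fun s : ℝ => s ^ 2) ‖e‖ ?_)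
    · simp only [Function.comp_apply]
      rw [hab, map_smul, smul_eq_mul]
    · exact hab s
    · exact Eventually.of_forall fun s => by rw [norm_smul, mul_comm]
  have h3 := h2.tendsto_div_nhds_zero.add_const (F' e)
  rw [zero_add] at h3
  refine h3.congr' ?_
  filter_upwards [self_mem_nhdsWithin] with s hs
  have hs : s ≠ 0 := hs
  field_simp
  ring

theorem stretch_const_zero {L : ℝ} (hL : 0 < L) (g : ℝ → ℝ) (t : ℝ) :
    stretch L (fun x => 0 * g x) t = t := by
  simp [stretch, hL.ne']

theorem hasDerivAt_integral_exp_mul {g : ℝ → ℝ} (hg : ContDiff ℝ ∞ g) (b : ℝ) :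
    HasDerivAt (fun s => ∫ x in (0 : ℝ)..b, Real.exp (s * g x)) (∫ x in (0 : ℝ)..b, g x) 0 := by
  obtain ⟨A, hA, hA1, hA2⟩ := exists_hadamard (f := fun z => Real.exp (z.1 * g z.2))
    (by fun_prop)
  have hA0 : ∀ x, A (0, x) = g x := fun x => by
    rw [hA2]
    have : HasDerivAt (fun s => Real.exp (s * g x)) (Real.exp (0 * g x) * (1 * g x)) 0 :=
      ((hasDerivAt_id' (0 : ℝ)).mul_const (g x)).exp
    simp [this.deriv]
  have ha : ContDiff ℝ ∞ fun s => ∫ x in (0 : ℝ)..b, A (s, x) := contDiff_parametric_integral hA 0 b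
  have h1 : (fun s => ∫ x in (0 : ℝ)..b, Real.exp (s * g x)) =
      fun s => b + s * ∫ x in (0 : ℝ)..b, A (s, x) := by
    funext s
    have h2 : ∀ x, Real.exp (s * g x) = 1 + s * A (s, x) := fun x => by
      simpa using hA1 s x
    simp_rw [h2]
    rw [intervalIntegral.integral_add intervalIntegrable_const
      (Continuous.intervalIntegrable (by fun_prop) _ _),
      intervalIntegral.integral_const_mul]
    simp
  rw [h1]
  have h3 := ((hasDerivAt_id' (0 : ℝ)).mul
    (ha.differentiable (by simp) 0).hasDerivAt).const_add b
  refine h3.congr_deriv ?_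
  simp [hA0]

/-- Since ∫₀ᴸ g = u(L) = 0, the normalising factor is stationary at s = 0, and only ∫₀ᵗ g = u(t)
remains. -/
theorem hasDerivAt_stretch_mul {L : ℝ} (hL : 0 < L) {g u : ℝ → ℝ} (hg : ContDiff ℝ ∞ g)
    (hu : ∀ t, HasDerivAt u (g t) t) (hu0 : u 0 = 0) (huL : u L = 0) (t : ℝ) :
    HasDerivAt (fun s => stretch L (fun x => s * g x) t) (u t) 0 := by
  have hi : ∀ b, ∫ x in (0 : ℝ)..b, g x = u b := fun b => by
    rw [intervalIntegral.integral_eq_sub_of_hasDerivAt (fun x _ => hu x)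
      (hg.continuous.intervalIntegrable _ _), hu0, sub_zero]
  have h1 := hasDerivAt_integral_exp_mul hg L
  have h2 := hasDerivAt_integral_exp_mul hg t
  rw [hi] at h1 h2
  rw [huL] at h1
  have h0 : ∫ x in (0 : ℝ)..L, Real.exp (0 * g x) = L := by simp
  have h3 := ((hasDerivAt_const (0 : ℝ) L).div h1 (by rw [h0]; exact hL.ne')).mul h2
  refine h3.congr_deriv ?_
  simp [hL.ne']

/-- First order expansion of `g ∘ φ_s` along the family with logarithmic derivative `s h`. -/
theorem exists_expansion {L : ℝ} (hL : 0 < L) {g h v : ℝ → ℝ} (hg : ContDiff ℝ ∞ g)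
    (hh : ContDiff ℝ ∞ h) (hv : ∀ t, HasDerivAt v (h t) t) (hv0 : v 0 = 0) (hvL : v L = 0) :
    ∃ A : ℝ × ℝ → ℝ, ContDiff ℝ ∞ A ∧
      (∀ s t, g (stretch L (fun x => s * h x) t) = g t + s * A (s, t)) ∧
      ∀ t, A (0, t) = deriv g t * v t := by
  have hs : ContDiff ℝ ∞ fun z : ℝ × ℝ => stretch L (fun x => z.1 * h x) z.2 :=
    contDiff_stretch_family (G := fun z : ℝ × ℝ => z.1 * h z.2) hL (by fun_prop)
  obtain ⟨A, hA, hA1, hA2⟩ := exists_hadamard (hg.comp hs)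
  refine ⟨A, hA, fun s t => ?_, fun t => ?_⟩
  · have := hA1 s t
    simp only [Function.comp_apply] at this
    rw [this, stretch_const_zero hL]
  · rw [hA2]
    have h1 := hasDerivAt_stretch_mul hL hh hv hv0 hvL t
    have h2 : HasDerivAt g (deriv g t) (stretch L (fun x => 0 * h x) t) := by
      rw [stretch_const_zero hL]
      exact (hg.differentiable (by simp) t).hasDerivAt
    exact (h2.comp (0 : ℝ) h1).deriv

theorem apply_arcArrow_congr (f : OneCochain (BreakPoints n) ℝ) (i : Fin n) {g h : ℝ → ℝ}
    {hg : ContDiff ℝ ∞ g} {hh : ContDiff ℝ ∞ h} (e : g = h) :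
    f (arcArrow i hg) = f (arcArrow i hh) := by
  subst e
  rfl

theorem contDiff_const_mul_fun {w : ℝ → ℝ} (hw : ContDiff ℝ ∞ w) (s : ℝ) :
    ContDiff ℝ ∞ fun t => s * w t := contDiff_const.mul hw

/-- The derivative of `f` at the identity, in the direction with logarithmic derivative `w` on the
`i`-th arc. -/
def arcDifferential (f : OneCochain (BreakPoints n) ℝ) (i : Fin n) {w : ℝ → ℝ}
    (hw : ContDiff ℝ ∞ w) : ℝ :=
  deriv (fun s => f (arcArrow i (contDiff_const_mul_fun hw s))) 0

theorem arcDifferential_congr (f : OneCochain (BreakPoints n) ℝ) (i : Fin n) {w w' : ℝ → ℝ}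
    {hw : ContDiff ℝ ∞ w} {hw' : ContDiff ℝ ∞ w'} (e : w = w') :
    arcDifferential f i hw = arcDifferential f i hw' := by
  subst e
  rfl

/-- Homogeneity is the only linearity of the differential used for the contradiction: one bracket
there is three times another. -/
theorem arcDifferential_const_mul (f : OneCochain (BreakPoints n) ℝ) (i : Fin n) {w : ℝ → ℝ}
    (hw : ContDiff ℝ ∞ w) (a : ℝ) :
    arcDifferential f i (contDiff_const_mul_fun hw a) = a * arcDifferential f i hw := by
  have h := deriv_comp_mul_left a (fun s => f (arcArrow i (contDiff_const_mul_fun hw s))) 0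
  rw [mul_zero, smul_eq_mul] at h
  rw [arcDifferential, arcDifferential, ← h]
  congr 1
  funext s
  exact apply_arcArrow_congr f i (by funext t; ring)

/-- If `c χ_i` is the coboundary of `f` on arrows supported in the `i`-th arc, then its
infinitesimal form is the coboundary of the differential of `f`. -/
theorem integral_eq_arcDifferential {f : OneCochain (BreakPoints n) ℝ} (hf : IsSmoothOneCochain f)
    {i : Fin n} {c : ℝ}
    (hc : ∀ {g h : ℝ → ℝ} (hg : ContDiff ℝ ∞ g) (hh : ContDiff ℝ ∞ h),
      c * bottCocycle n (arcArrow i hg) (arcArrow i hh) i =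
        f (arcArrow i hg) + f (arcArrow i hh) - f (arcArrow i hh ≫ arcArrow i hg))
    {g h u v : ℝ → ℝ} (hg : ContDiff ℝ ∞ g) (hh : ContDiff ℝ ∞ h)
    (hu : ∀ t, HasDerivAt u (g t) t) (hv : ∀ t, HasDerivAt v (h t) t)
    (hu0 : u 0 = 0) (huL : u (n : ℝ)⁻¹ = 0) (hv0 : v 0 = 0) (hvL : v (n : ℝ)⁻¹ = 0)
    (hgL : g (n : ℝ)⁻¹ = g 0) (hhL : h (n : ℝ)⁻¹ = h 0)
    (hw : ContDiff ℝ ∞ fun t => deriv h t * u t - deriv g t * v t) :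
    c * (∫ t in (0 : ℝ)..(n : ℝ)⁻¹, (g t * deriv h t - h t * deriv g t)) =
      arcDifferential f i hw := by
  have hn := inv_natCast_pos n
  obtain ⟨A, hA, hA1, hA0⟩ := exists_expansion hn hg hh hv hv0 hvL
  obtain ⟨B, hB, hB1, hB0⟩ := exists_expansion hn hh hg hu hu0 huL
  have dg : Continuous (deriv g) := hg.continuous_deriv (by simp)
  have dh : Continuous (deriv h) := hh.continuous_deriv (by simp)
  -- One smooth family contains both products: by `stretch_stretch`, φψ has logarithmic derivative
  -- s(g + h) + s²A and ψφ has s(g + h) + s²B, up to constants. They are the parameters `b s` and `a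
  -- s`, which differ by s²(0, -1, 1).
  let G : (Fin 3 → ℝ) × ℝ → ℝ := fun z =>
    z.1 0 * (g z.2 + h z.2) + z.1 1 * A (z.1 0, z.2) + z.1 2 * B (z.1 0, z.2)
  have hG : ContDiff ℝ ∞ G := by fun_prop
  have hGτ : ∀ τ, ContDiff ℝ ∞ fun t => G (τ, t) := fun τ => hG.comp (by fun_prop)
  let F : (Fin 3 → ℝ) → ℝ := fun τ => f (arcArrow i (hGτ τ))
  have hF : ContDiff ℝ ∞ F := hf _ (isSmoothFamily_arcArrow i hG hGτ)
  have hF' := hF.contDiffAt.hasStrictFDerivAt (x := 0) (by simp)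
  let a : ℝ → Fin 3 → ℝ := fun s => ![s, 0, s ^ 2]
  let b : ℝ → Fin 3 → ℝ := fun s => ![s, s ^ 2, 0]
  have h0 : (![0, 0, 0] : Fin 3 → ℝ) = 0 := by
    ext j
    fin_cases j <;> rfl
  have hca : Continuous a := continuous_pi fun j => by
    fin_cases j <;> simp [a] <;> fun_prop
  have hcb : Continuous b := continuous_pi fun j => by
    fin_cases j <;> simp [b] <;> fun_prop
  have ha : Tendsto a (𝓝[≠] 0) (𝓝 0) := by
    have := (hca.tendsto 0).mono_left (nhdsWithin_le_nhds (s := {0}ᶜ))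
    simpa [a, h0] using this
  have hb : Tendsto b (𝓝[≠] 0) (𝓝 0) := by
    have := (hcb.tendsto 0).mono_left (nhdsWithin_le_nhds (s := {0}ᶜ))
    simpa [b, h0] using this
  have hlim := tendsto_sub_div_sq (e := ![0, -1, 1]) hF' ha hb fun s => by
    ext j
    fin_cases j <;> simp [a, b]
  -- Along this line the first parameter is 0, so the logarithmic derivative is s(B(0, ·) - A(0, ·))
  -- = s(h' u - g' v).
  have hval : fderiv ℝ F 0 ![0, -1, 1] = arcDifferential f i hw := by
    have hl : HasDerivAt (fun s : ℝ => s • (![0, -1, 1] : Fin 3 → ℝ)) (![0, -1, 1]) 0 := by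
      simpa using (hasDerivAt_id' (0 : ℝ)).smul_const (![0, -1, 1] : Fin 3 → ℝ)
    have h1 : HasFDerivAt F (fderiv ℝ F 0) ((0 : ℝ) • (![0, -1, 1] : Fin 3 → ℝ)) := by
      rw [zero_smul]
      exact hF'.hasFDerivAt
    rw [← (h1.comp_hasDerivAt (0 : ℝ) hl).deriv, arcDifferential]
    congr 1
    funext s
    change f (arcArrow i (hGτ (s • ![0, -1, 1]))) = _
    refine apply_arcArrow_congr f i ?_
    funext t
    simp [G, hA0, hB0]
    ring
  rw [hval] at hlim
  have hφψ : ∀ s, F (a s) - F (b s) = s ^ 2 * (c * ∫ t in (0 : ℝ)..(n : ℝ)⁻¹,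
      ((g t + s * A (s, t)) * deriv h t - (h t + s * B (s, t)) * deriv g t)) := by
    intro s
    have hsg := contDiff_const_mul_fun hg s
    have hsh := contDiff_const_mul_fun hh s
    have e1 : f (arcArrow i hsh ≫ arcArrow i hsg) = F (b s) := by
      rw [arcArrow_comp]
      change _ = f (arcArrow i (hGτ _))
      refine apply_arcArrow_congr f i ?_
      funext t
      simp [G, b, hA1]
      ring
    have e2 : f (arcArrow i hsg ≫ arcArrow i hsh) = F (a s) := by
      rw [arcArrow_comp]
      change _ = f (arcArrow i (hGτ _))
      refine apply_arcArrow_congr f i ?_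
      funext t
      simp [G, a, hB1]
      ring
    have e3 := hc hsg hsh
    have e4 := hc hsh hsg
    rw [e1, bottCocycle_arcArrow_self i hsg hsh (by rw [hhL])] at e3
    rw [e2, bottCocycle_arcArrow_self i hsh hsg (by rw [hgL])] at e4
    have e5 : F (a s) - F (b s) = c * (∫ t in (0 : ℝ)..(n : ℝ)⁻¹,
        s * g (stretch (n : ℝ)⁻¹ (fun t => s * h t) t) * deriv (fun t => s * h t) t) -
        c * ∫ t in (0 : ℝ)..(n : ℝ)⁻¹,
        s * h (stretch (n : ℝ)⁻¹ (fun t => s * g t) t) * deriv (fun t => s * g t) t := by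
      rw [e3, e4]
      ring
    simp only [hA1, hB1, deriv_const_mul_field] at e5
    rw [e5, ← mul_sub, ← intervalIntegral.integral_sub, mul_left_comm (s ^ 2) c,
      ← intervalIntegral.integral_const_mul (s ^ 2)]
    · congr 2
      funext t
      ring
    · exact Continuous.intervalIntegrable (by fun_prop) _ _
    · exact Continuous.intervalIntegrable (by fun_prop) _ _
  have hcont : Continuous fun s => c * ∫ t in (0 : ℝ)..(n : ℝ)⁻¹,
      ((g t + s * A (s, t)) * deriv h t - (h t + s * B (s, t)) * deriv g t) :=
    continuous_const.mul (intervalIntegral.continuous_parametric_intervalIntegral_of_continuous'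
      (by fun_prop) _ _)
  have hlim' := (hcont.tendsto 0).mono_left (nhdsWithin_le_nhds (s := {0}ᶜ))
  simp only [zero_mul, add_zero] at hlim'
  -- Both sides are limits of (F(a s) - F(b s)) / s².
  refine tendsto_nhds_unique hlim' (hlim.congr' ?_)
  filter_upwards [self_mem_nhdsWithin] with s hs
  have hs : s ≠ 0 := hs
  rw [hφψ, mul_div_cancel_left₀ _ (pow_ne_zero 2 hs)]

end Infinitesimal

/-! ### Nontriviality -/

section Nontrivial

open Polynomial

theorem contDiff_eval (P : ℝ[X]) : ContDiff ℝ ∞ fun t => P.eval t := by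
  simpa using P.contDiff_aeval (𝕜 := ℝ) ∞

/-- A polynomial which vanishes to second order at `0` and at `L`. -/
def bump (L : ℝ) : ℝ[X] := X ^ 2 * (C L - X) ^ 2

/-- Multiples of `bump` vanish at both ends together with their first derivatives, which supplies
every boundary condition on the fields and on their derivatives. -/
theorem integral_bump_eq_arcDifferential {f : OneCochain (BreakPoints n) ℝ}
    (hf : IsSmoothOneCochain f) {i : Fin n} {c : ℝ}
    (hc : ∀ {g h : ℝ → ℝ} (hg : ContDiff ℝ ∞ g) (hh : ContDiff ℝ ∞ h),
      c * bottCocycle n (arcArrow i hg) (arcArrow i hh) i =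
        f (arcArrow i hg) + f (arcArrow i hh) - f (arcArrow i hh ≫ arcArrow i hg))
    {U V : ℝ[X]} (hU : bump (n : ℝ)⁻¹ ∣ U) (hV : bump (n : ℝ)⁻¹ ∣ V) :
    c * (∫ t in (0 : ℝ)..(n : ℝ)⁻¹, (derivative U * derivative (derivative V) -
        derivative V * derivative (derivative U)).eval t) =
      arcDifferential f i (contDiff_eval (derivative (derivative V) * U -
        derivative (derivative U) * V)) := by
  have hz : ∀ {W : ℝ[X]}, bump (n : ℝ)⁻¹ ∣ W → W.eval 0 = 0 ∧ W.eval (n : ℝ)⁻¹ = 0 ∧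
      (derivative W).eval (n : ℝ)⁻¹ = (derivative W).eval 0 := by
    rintro _ ⟨W, rfl⟩
    simp [bump, derivative_mul, derivative_pow]
  obtain ⟨hU0, hUL, hU1⟩ := hz hU
  obtain ⟨hV0, hVL, hV1⟩ := hz hV
  have h := integral_eq_arcDifferential hf hc (g := fun t => (derivative U).eval t)
    (h := fun t => (derivative V).eval t) (contDiff_eval (derivative U)) (contDiff_eval (derivative V))
    (fun t => U.hasDerivAt t) (fun t => V.hasDerivAt t) hU0 hUL hV0 hVL hU1 hV1
    (by
      simp only [Polynomial.deriv]
      exact ((contDiff_eval (derivative (derivative V))).mul (contDiff_eval U)).sub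
        ((contDiff_eval (derivative (derivative U))).mul (contDiff_eval V)))
  simp only [eval_sub, eval_mul]
  simp only [Polynomial.deriv] at h
  exact h

theorem not_isCoboundary_sum_bottCocycle {c : Fin n → ℝ} (hc : c ≠ 0) :
    ¬ IsCoboundary (fun _ _ _ φ ψ => ∑ i, c i * bottCocycle n φ ψ i :
      TwoCochain (BreakPoints n) ℝ) := by
  rintro ⟨f, hf, hχ⟩
  obtain ⟨i, hi⟩ := Function.ne_iff.1 hc
  have hcob : ∀ {g h : ℝ → ℝ} (hg : ContDiff ℝ ∞ g) (hh : ContDiff ℝ ∞ h),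
      c i * bottCocycle n (arcArrow i hg) (arcArrow i hh) i =
        f (arcArrow i hg) + f (arcArrow i hh) - f (arcArrow i hh ≫ arcArrow i hg) := by
    intro g h hg hh
    have h1 : ∑ j, c j * bottCocycle n (arcArrow i hg) (arcArrow i hh) j =
        f (arcArrow i hg) + f (arcArrow i hh) - f (arcArrow i hh ≫ arcArrow i hg) :=
      congrFun (congrFun (congrFun (congrFun (congrFun hχ _) _) _) (arcArrow i hg))
        (arcArrow i hh)
    rw [← h1, Finset.sum_eq_single i]
    · intro j _ hij
      rw [bottCocycle_arcArrow_of_ne hij, mul_zero]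
    · simp
  have hn := inv_natCast_pos n
  set H := bump (n : ℝ)⁻¹ with hH
  -- For fields Ha and Hb the bracket is H²(ab' - ba'): 3H²t² for (1, t³) and H²t² for (t, t²).
  have e1 := integral_bump_eq_arcDifferential hf hcob (U := H) (V := H * X ^ 3) dvd_rfl
    (dvd_mul_right _ _)
  have e2 := integral_bump_eq_arcDifferential hf hcob (U := H * X) (V := H * X ^ 2)
    (dvd_mul_right _ _) (dvd_mul_right _ _)
  have e3 : c i * (∫ t in (0 : ℝ)..(n : ℝ)⁻¹, (derivative H * derivative (derivative (H * X ^ 3)) -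
        derivative (H * X ^ 3) * derivative (derivative H)).eval t) =
      3 * (c i * ∫ t in (0 : ℝ)..(n : ℝ)⁻¹,
        (derivative (H * X) * derivative (derivative (H * X ^ 2)) -
        derivative (H * X ^ 2) * derivative (derivative (H * X))).eval t) := by
    rw [e1, e2, ← arcDifferential_const_mul]
    refine arcDifferential_congr f i ?_
    funext t
    simp [derivative_mul, derivative_pow]
    ring
  rw [mul_left_comm (3 : ℝ), ← intervalIntegral.integral_const_mul 3] at e3
  have e4 := mul_left_cancel₀ hi e3
  rw [← sub_eq_zero, ← intervalIntegral.integral_sub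
    ((Polynomial.continuous _).intervalIntegrable _ _)
    (Continuous.intervalIntegrable (by fun_prop) _ _)] at e4
  -- All terms with derivatives of H cancel identically in the difference of the integrands.
  have e5 : ∫ t in (0 : ℝ)..(n : ℝ)⁻¹, -(6 * H.eval t ^ 2) = 0 := by
    rw [← e4]
    congr 1
    funext t
    simp [derivative_mul, derivative_pow]
    ring
  have e6 : 0 < ∫ t in (0 : ℝ)..(n : ℝ)⁻¹, 6 * H.eval t ^ 2 := by
    refine intervalIntegral.intervalIntegral_pos_of_pos_on
      (Continuous.intervalIntegrable (by fun_prop) _ _) (fun t ht => ?_) hn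
    have h1 : 0 < t := ht.1
    have h2 : 0 < (n : ℝ)⁻¹ - t := sub_pos.2 ht.2
    simp only [hH, bump, eval_mul, eval_pow, eval_X, eval_sub, eval_C]
    positivity
  rw [intervalIntegral.integral_neg, neg_eq_zero] at e5
  exact e6.ne' e5

theorem not_isCoboundary_bottCocycle (n : ℕ) [NeZero n] : ¬ IsCoboundary (bottCocycle n) := by
  rintro ⟨f, hf, hχ⟩
  refine not_isCoboundary_sum_bottCocycle (n := n) (c := fun _ => 1)
    (fun h => one_ne_zero (congrFun h 0)) ⟨fun a b φ => ∑ i, f φ i, ?_, ?_⟩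
  · intro k p q φ hφ
    exact ContDiff.sum fun i _ => contDiff_pi.1 (hf φ hφ) i
  · funext a b c φ ψ
    simp [hχ, coboundary, Finset.sum_add_distrib, Finset.sum_sub_distrib]

/-- The second component of F(φ, 0) is the required cochain: multiplicativity on (φ, 0)(ψ, 0) = (φψ,
χ(φ, ψ)) together with equivariance is the coboundary equation. -/
theorem IsTrivialExtension.isCoboundary {A : Type*} [NormedAddCommGroup A] [NormedSpace ℝ A]
    {χ : TwoCochain (BreakPoints n) A} {h : IsTwoCocycle χ} (hT : IsTrivialExtension h) :
    IsCoboundary χ := by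
  obtain ⟨F, hF⟩ := hT
  have hadd : ∀ {a b : BreakPoints n} (φ : a ⟶ b) (t : A),
      (F.equiv (a := a) (b := b) (φ, t)).2 = (F.equiv (a := a) (b := b) (φ, 0)).2 + t := by
    intro a b φ t
    have := F.map_add φ 0 t
    rwa [zero_add] at this
  refine ⟨fun a b φ => (F.equiv (a := a) (b := b) (φ, 0)).2, ?_, ?_⟩
  · intro k p q φ hφ
    exact ((hF (p := p) (q := q)).1 (fun τ => (φ τ, 0)) ⟨hφ, contDiff_const⟩).2
  · funext a b c φ ψ
    have h1 := congrArg Prod.snd (F.map_comp (a := a) (b := b) (c := c) (ψ, 0) (φ, 0))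
    change (F.equiv (a := a) (b := c) (ψ ≫ φ, 0 + 0 + χ φ ψ)).2 =
      (F.equiv (a := b) (b := c) (φ, 0)).2 + (F.equiv (a := a) (b := b) (ψ, 0)).2 + 0 at h1
    rw [hadd] at h1
    rw [add_zero, zero_add, add_zero] at h1
    change _ = (F.equiv (a := b) (b := c) (φ, 0)).2 + (F.equiv (a := a) (b := b) (ψ, 0)).2 -
      (F.equiv (a := a) (b := c) (ψ ≫ φ, 0)).2
    rw [← h1, add_sub_cancel_left]

end Nontrivial

end BrokenVirasoro

end

theorem mainTheorem6 (n : ℕ) [NeZero n] :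
    ∃ h : BrokenVirasoro.IsTwoCocycle (BrokenVirasoro.bottCocycle n),
      BrokenVirasoro.IsSmoothTwoCochain (BrokenVirasoro.bottCocycle n) ∧
      ¬ BrokenVirasoro.IsCoboundary (BrokenVirasoro.bottCocycle n) ∧
      ¬ BrokenVirasoro.IsTrivialExtension h ∧
      ∀ c : Fin n → ℝ, c ≠ 0 →
        ¬ BrokenVirasoro.IsCoboundary
          (fun _ _ _ φ ψ => ∑ i, c i * BrokenVirasoro.bottCocycle n φ ψ i) :=
  ⟨BrokenVirasoro.isTwoCocycle_bottCocycle n, BrokenVirasoro.isSmoothTwoCochain_bottCocycle n,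
    BrokenVirasoro.not_isCoboundary_bottCocycle n,
    fun hT => BrokenVirasoro.not_isCoboundary_bottCocycle n hT.isCoboundary,
    fun _ hc => BrokenVirasoro.not_isCoboundary_sum_bottCocycle hc⟩
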